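/- For $u,v\in\mathbb{R}^6$ put $\langle u,v\rangle=-u_1v_1-u_2v_2-u_3v_3+u_4v_4+u_5v_5+u_6v_6$, and let $S^5_3=\{x\in\mathbb{R}^6 : \langle x,x\rangle=1\}$ be the pseudo-sphere of index $3$, with Levi-Civita connection $\bar\nabla$. Let $M$ be a smooth connected $4$-dimensional non-degenerate (immersed) hypersurface of $S^5_3$ with a smooth unit normal vector field $\xi$ (so $\langle\xi,\xi\rangle=\pm1$), induced metric $g$ and shape operator $A(X)=-\bar\nabla_X\xi$. The principal curvatures of $M$ at $p$ are the (real or complex) eigenvalues of $A_p$, that is, the eigenvalues of its complexification. Assume that (1) $M$ is isoparametric: its principal curvatures are constant on $M$; and (2) the Petrov type of $M$ is type IV of index $2$: at every $p\in M$ there are real numbers $\alpha,\beta,b$ with $\beta>0$, a sign $\varepsilon\in\{1,-1\}$ and a basis of $T_pM$ in which $A_p$ and $g_p$ have the matrices $$A_p\sim\begin{pmatrix}\alpha&-\beta&0&0\\ \beta&\alpha&0&0\\ 0&0&b&1\\ 0&0&0&b\end{pmatrix},\qquad g_p\sim\begin{pmatrix}-1&0&0&0\\ 0&1&0&0\\ 0&0&0&\varepsilon\\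 0&0&\varepsilon&0\end{pmatrix}.$$ Then every complex (that is, non-real) principal curvature $\lambda\in\mathbb{C}\setminus\mathbb{R}$ of $M$, at any point, satisfies $|\lambda|=1$. -/

import Mathlib

open scoped Manifold ContDiff TensorProduct

noncomputable section

namespace PseudoSphere

/-- The pseudo-inner product `⟨u, v⟩_s = -∑_{i < s} u_i v_i + ∑_{i ≥ s} u_i v_i` of `ℝ^n_s`. -/
def pseudoInner (n s : ℕ) : LinearMap.BilinForm ℝ (EuclideanSpace ℝ (Fin n)) :=
  LinearMap.mk₂ ℝ (fun u v => ∑ i : Fin n, (if (i : ℕ) < s then (-1 : ℝ) else 1) * (u i * v i))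
    (fun u u' v => by simp only [PiLp.add_apply, ← Finset.sum_add_distrib]; congr; ext; ring)
    (fun c u v => by
      simp only [PiLp.smul_apply, smul_eq_mul, Finset.mul_sum]; congr; ext; ring)
    (fun u v v' => by simp only [PiLp.add_apply, ← Finset.sum_add_distrib]; congr; ext; ring)
    (fun c u v => by
      simp only [PiLp.smul_apply, smul_eq_mul, Finset.mul_sum]; congr; ext; ring)

theorem pseudoInner_apply (n s : ℕ) (u v : EuclideanSpace ℝ (Fin n)) :
    pseudoInner n s u v = ∑ i : Fin n, (if (i : ℕ) < s then (-1 : ℝ) else 1) * (u i * v i) :=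
  rfl

theorem pseudoInner_comm (n s : ℕ) (u v : EuclideanSpace ℝ (Fin n)) :
    pseudoInner n s u v = pseudoInner n s v u := by
  simp only [pseudoInner_apply, mul_comm (u _)]

theorem pseudoInner_nondegenerate (n s : ℕ) : (pseudoInner n s).Nondegenerate := by
  have key : ∀ u : EuclideanSpace ℝ (Fin n), (∀ v, pseudoInner n s u v = 0) → u = 0 := by
    intro u hu
    ext i
    have h := hu (EuclideanSpace.single i 1)
    rw [pseudoInner_apply, Finset.sum_eq_single i] at h
    · by_cases hi : (i : ℕ) < s <;> simpa [hi] using h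
    · intro j _ hj
      simp [hj]
    · simp
  exact ⟨key, fun u hu => key u fun v => (pseudoInner_comm n s u v).trans (hu v)⟩

theorem exists_hasFDerivAt_self {E : Type*} [NormedAddCommGroup E] [NormedSpace ℝ E]
    [FiniteDimensional ℝ E] (B : LinearMap.BilinForm ℝ E) (x : E) :
    ∃ Q : E →L[ℝ] ℝ, HasFDerivAt (fun y => B y y) Q x ∧ ∀ v, Q v = B x v + B v x := by
  let B' : E →L[ℝ] E →L[ℝ] ℝ := LinearMap.toContinuousLinearMap
    ((LinearMap.toContinuousLinearMap (𝕜 := ℝ) (E := E) (F' := ℝ)).toLinearMap.comp B)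
  exact ⟨_, B'.hasFDerivAt_of_bilinear (hasFDerivAt_id x) (hasFDerivAt_id x), fun v => rfl⟩

/-- The pseudo-sphere `S^n_s = {x ∈ ℝ^{n+1}_s | ⟨x, x⟩_s = 1}`; when `s = n` this set has two
components, and `S^n_n` is the one on which the last coordinate is positive. -/
def pseudoSphere (n s : ℕ) : Set (EuclideanSpace ℝ (Fin (n + 1))) :=
  {x | pseudoInner (n + 1) s x x = 1 ∧ (s = n → 0 < x (Fin.last n))}

/-- A smooth (immersed) non-degenerate hypersurface of dimension `n` in `S^{n+1}_s`, with a
unit normal vector field along it. A hypersurface that is a subset of `S^{n+1}_s` is the case in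
which `toFun` is its inclusion map. -/
structure Hypersurface (n s : ℕ) (M : Type*) [TopologicalSpace M]
    [ChartedSpace (EuclideanSpace ℝ (Fin n)) M] where
  /-- The immersion, as a map into `ℝ^{n+2}_s`. -/
  toFun : M → EuclideanSpace ℝ (Fin (n + 2))
  smooth : ContMDiff (𝓡 n) 𝓘(ℝ, EuclideanSpace ℝ (Fin (n + 2))) ∞ toFun
  mem_sphere : ∀ p, toFun p ∈ pseudoSphere (n + 1) s
  immersion : ∀ p, Function.Injective
    (mfderiv (𝓡 n) 𝓘(ℝ, EuclideanSpace ℝ (Fin (n + 2))) toFun p)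
  /-- The induced metric is non-degenerate at every point. -/
  nondegenerate : ∀ (p : M) (v : TangentSpace (𝓡 n) p),
    (∀ w : TangentSpace (𝓡 n) p,
      pseudoInner (n + 2) s
        (mfderiv (𝓡 n) 𝓘(ℝ, EuclideanSpace ℝ (Fin (n + 2))) toFun p v)
        (mfderiv (𝓡 n) 𝓘(ℝ, EuclideanSpace ℝ (Fin (n + 2))) toFun p w) = 0) → v = 0
  /-- The unit normal vector field `ξ`. -/
  normal : M → EuclideanSpace ℝ (Fin (n + 2))
  normal_smooth : ContMDiff (𝓡 n) 𝓘(ℝ, EuclideanSpace ℝ (Fin (n + 2))) ∞ normal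
  /-- `ξ` is tangent to the pseudo-sphere. -/
  normal_tangent : ∀ p, pseudoInner (n + 2) s (normal p) (toFun p) = 0
  /-- `ξ` is orthogonal to the hypersurface. -/
  normal_orthogonal : ∀ (p : M) (v : TangentSpace (𝓡 n) p),
    pseudoInner (n + 2) s (normal p)
      (mfderiv (𝓡 n) 𝓘(ℝ, EuclideanSpace ℝ (Fin (n + 2))) toFun p v) = 0
  /-- The sign `ν = ⟨ξ, ξ⟩`. -/
  sign : ℝ
  sign_eq : sign = 1 ∨ sign = -1
  normal_unit : ∀ p, pseudoInner (n + 2) s (normal p) (normal p) = sign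

namespace Hypersurface

variable {n s : ℕ} {M : Type*} [TopologicalSpace M] [ChartedSpace (EuclideanSpace ℝ (Fin n)) M]

/-- The derivative at `p` of a map `η` from the hypersurface to `ℝ^{n+2}`, as a linear map. -/
def diff (η : M → EuclideanSpace ℝ (Fin (n + 2))) (p : M) :
    TangentSpace (𝓡 n) p →ₗ[ℝ] EuclideanSpace ℝ (Fin (n + 2)) :=
  (mfderiv (𝓡 n) 𝓘(ℝ, EuclideanSpace ℝ (Fin (n + 2))) η p).toLinearMap

/-- The induced metric (first fundamental form) at `p`. -/
def metric (X : Hypersurface n s M) (p : M) : LinearMap.BilinForm ℝ (TangentSpace (𝓡 n) p) :=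
  (pseudoInner (n + 2) s).compl₁₂ (diff X.toFun p) (diff X.toFun p)

/-- The covariant derivative `v ↦ ∇̄_v η` at `p` of a vector field `η` along the hypersurface,
for the Levi-Civita connection of the pseudo-sphere: the flat derivative `D_v η` in `ℝ^{n+2}_s`,
projected orthogonally to the tangent space `x^⊥` of the pseudo-sphere at `x`
(recall `⟨x, x⟩_s = 1`). -/
def covDeriv (X : Hypersurface n s M) (η : M → EuclideanSpace ℝ (Fin (n + 2))) (p : M) :
    TangentSpace (𝓡 n) p →ₗ[ℝ] EuclideanSpace ℝ (Fin (n + 2)) :=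
  diff η p - (((pseudoInner (n + 2) s).flip (X.toFun p)).comp (diff η p)).smulRight (X.toFun p)

theorem covDeriv_apply (X : Hypersurface n s M) (η : M → EuclideanSpace ℝ (Fin (n + 2))) (p : M)
    (v : TangentSpace (𝓡 n) p) :
    X.covDeriv η p v =
      diff η p v - pseudoInner (n + 2) s (diff η p v) (X.toFun p) • X.toFun p :=
  rfl

theorem diff_injective (X : Hypersurface n s M) (p : M) :
    Function.Injective (diff X.toFun p) :=
  X.immersion p

/-- The derivative of a constant quadratic expression `⟨η, η⟩` vanishes. -/
theorem pseudoInner_diff_self {η : M → EuclideanSpace ℝ (Fin (n + 2))}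
    (hη : ContMDiff (𝓡 n) 𝓘(ℝ, EuclideanSpace ℝ (Fin (n + 2))) ∞ η) {c : ℝ}
    (hc : ∀ p, pseudoInner (n + 2) s (η p) (η p) = c) (p : M) (v : TangentSpace (𝓡 n) p) :
    pseudoInner (n + 2) s (diff η p v) (η p) = 0 := by
  obtain ⟨Q, h1, hQ⟩ := exists_hasFDerivAt_self (pseudoInner (n + 2) s) (η p)
  have h2 : HasMFDerivAt (𝓡 n) 𝓘(ℝ, EuclideanSpace ℝ (Fin (n + 2))) η p _ :=
    (hη.mdifferentiable (by simp) p).hasMFDerivAt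
  have h3 := h1.hasMFDerivAt.comp p h2
  have h4 : ((fun x => pseudoInner (n + 2) s x x) ∘ η) = fun _ => c := funext fun q => hc q
  rw [h4] at h3
  have h5 := hasMFDerivAt_unique h3 (hasMFDerivAt_const c p)
  have h6 : Q (diff η p v) = 0 := DFunLike.congr_fun h5 v
  rw [hQ, pseudoInner_comm] at h6
  linarith

/-- `∇̄_v ξ` is tangent to the hypersurface. -/
theorem covDeriv_normal_mem_range (X : Hypersurface n s M) (p : M) (v : TangentSpace (𝓡 n) p) :
    X.covDeriv X.normal p v ∈ LinearMap.range (diff X.toFun p) := by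
  have hxx : pseudoInner (n + 2) s (X.toFun p) (X.toFun p) = 1 := (X.mem_sphere p).1
  have hnx := X.normal_tangent p
  have hnn := X.normal_unit p
  have hs : X.sign ≠ 0 := by rcases X.sign_eq with h | h <;> simp [h]
  have hdx : ∀ w, pseudoInner (n + 2) s (diff X.toFun p w) (X.toFun p) = 0 :=
    pseudoInner_diff_self X.smooth (fun q => (X.mem_sphere q).1) p
  have hdn : ∀ w, pseudoInner (n + 2) s (diff X.normal p w) (X.normal p) = 0 :=
    pseudoInner_diff_self X.normal_smooth X.normal_unit p
  -- the map `u ↦ (⟨u, x⟩, ⟨u, ξ⟩)`, whose kernel is the tangent space of the hypersurface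
  let L : EuclideanSpace ℝ (Fin (n + 2)) →ₗ[ℝ] ℝ × ℝ :=
    ((pseudoInner (n + 2) s).flip (X.toFun p)).prod ((pseudoInner (n + 2) s).flip (X.normal p))
  have hL : ∀ u, L u = (pseudoInner (n + 2) s u (X.toFun p),
    pseudoInner (n + 2) s u (X.normal p)) := fun _ => rfl
  have hsurj : LinearMap.range L = ⊤ := by
    rw [LinearMap.range_eq_top]
    rintro ⟨a, b⟩
    refine ⟨a • X.toFun p + (b / X.sign) • X.normal p, ?_⟩
    rw [hL]
    simp only [map_add, map_smul, LinearMap.add_apply, LinearMap.smul_apply, hxx, hnx, hnn,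
      pseudoInner_comm _ _ (X.toFun p) (X.normal p), smul_eq_mul]
    ext <;> simp [hs]
  have hle : LinearMap.range (diff X.toFun p) ≤ LinearMap.ker L := by
    rintro _ ⟨w, rfl⟩
    rw [LinearMap.mem_ker, hL, hdx, pseudoInner_comm]
    exact Prod.ext rfl (X.normal_orthogonal p w)
  have hfin : Module.finrank ℝ (LinearMap.range (diff X.toFun p)) = n := by
    rw [LinearMap.finrank_range_of_inj (X.diff_injective p)]
    exact finrank_euclideanSpace_fin
  have hker : Module.finrank ℝ (LinearMap.ker L) = n := by
    have h := LinearMap.finrank_range_add_finrank_ker L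
    rw [hsurj, finrank_top, Module.finrank_prod, Module.finrank_self,
      finrank_euclideanSpace_fin] at h
    omega
  rw [Submodule.eq_of_le_of_finrank_eq hle (hfin.trans hker.symm), LinearMap.mem_ker, hL,
    covDeriv_apply]
  simp [hxx, hdn, pseudoInner_comm _ _ (X.toFun p) (X.normal p), hnx]

/-- The shape operator `A v = -∇̄_v ξ` at `p`, where the tangent space of the hypersurface is
identified with its image under the derivative of the immersion. -/
def shapeOperator (X : Hypersurface n s M) (p : M) :
    TangentSpace (𝓡 n) p →ₗ[ℝ] TangentSpace (𝓡 n) p :=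
  (LinearEquiv.ofInjective (diff X.toFun p) (X.diff_injective p)).symm.toLinearMap.comp
    (LinearMap.codRestrict (LinearMap.range (diff X.toFun p)) (-(X.covDeriv X.normal p))
      (fun v => Submodule.neg_mem _ (X.covDeriv_normal_mem_range p v)))

theorem diff_shapeOperator (X : Hypersurface n s M) (p : M) (v : TangentSpace (𝓡 n) p) :
    diff X.toFun p (X.shapeOperator p v) = -(X.covDeriv X.normal p v) := by
  have h := LinearEquiv.apply_symm_apply
    (LinearEquiv.ofInjective (diff X.toFun p) (X.diff_injective p))
    (LinearMap.codRestrict (LinearMap.range (diff X.toFun p)) (-(X.covDeriv X.normal p))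
      (fun v => Submodule.neg_mem _ (X.covDeriv_normal_mem_range p v)) v)
  exact congrArg Subtype.val h

/-- `μ` is a principal curvature at `p`: an eigenvalue of the complexified shape operator. -/
def IsPrincipalCurvatureAt (X : Hypersurface n s M) (p : M) (μ : ℂ) : Prop :=
  Module.End.HasEigenvalue ((X.shapeOperator p).baseChange ℂ) μ

/-- The hypersurface is isoparametric: its (real and complex) principal curvatures are the same
at all points. -/
def IsIsoparametric (X : Hypersurface n s M) : Prop :=
  ∀ (p q : M) (μ : ℂ), X.IsPrincipalCurvatureAt p μ ↔ X.IsPrincipalCurvatureAt q μ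

end Hypersurface

/-- The pair of an endomorphism `A` and a bilinear form `B` is of type IV of index 2 (in
dimension 4): in some basis they have the matrices below. -/
def IsPetrovTypeIV {V : Type*} [AddCommGroup V] [Module ℝ V] (A : V →ₗ[ℝ] V)
    (B : LinearMap.BilinForm ℝ V) : Prop :=
  ∃ (α β b ε : ℝ) (e : Module.Basis (Fin 4) ℝ V),
    0 < β ∧ (ε = 1 ∨ ε = -1) ∧
    LinearMap.toMatrix e e A =
      !![α, -β, 0, 0;
         β,  α, 0, 0;
         0,  0, b, 1;
         0,  0, 0, b] ∧
    Matrix.of (fun i j => B (e i) (e j)) =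
      !![-1, 0, 0, 0;
          0, 1, 0, 0;
          0, 0, 0, ε;
          0, 0, ε, 0]

/-- The Petrov type of the hypersurface is type IV of index 2: the shape operator and the induced
metric are of that type at every point. -/
def Hypersurface.HasPetrovTypeIV {s : ℕ} {M : Type*} [TopologicalSpace M]
    [ChartedSpace (EuclideanSpace ℝ (Fin 4)) M] (X : Hypersurface 4 s M) : Prop :=
  ∀ p : M, IsPetrovTypeIV (X.shapeOperator p) (X.metric p)

end PseudoSphere

end

/-! The proof complexifies the moving frame. At the base point the operator is diagonalizable over ℂ
on the first two basis vectors, with eigenvalues `l₁ = α + iβ` and `l₂ = α - iβ`, and has one Jordan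
block for `b`. Isoparametricity together with the fixed Petrov type makes the characteristic
polynomial constant. Applying fixed polynomials in `A` to constant complex vectors therefore gives
smooth sections of the eigenspaces and of the Jordan chain near the point. Over ℂ every nonvanishing
smooth germ has a smooth square root, so these sections can be normalized to a frame in which both
the metric and `A` have constant coefficients (`exists_adapted_frame`).

In such a frame the Codazzi equation is a linear system for the connection coefficients `Γ i j k =
⟨∇_i V_j, V_k⟩`. As `l₁`, `l₂`, `b` are distinct, it kills many of them and makes `Γ 1 0 2` and `Γ 2
0 1` multiples of `w = Γ 0 1 2`. The Gauss equation for the plane of `V_0` and the null eigenvector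
`V_2` has no curvature term and reduces to `2 (l₁ - b)(l₂ - b) w² = 0` up to a nonzero factor, so
`w` vanishes. The Gauss equation for the plane of `V_0` and `V_1` then loses all its connection
terms and leaves `1 + ν l₁ l₂ = 0`, where `ν = ⟨ξ, ξ⟩` (`frame_curvature`). Since `l₁ l₂ = α² + β² >
0`, this forces `ν = -1` and `|l₁| = |l₂| = 1`.

The computation is carried out over an abstract commutative ℂ-algebra with derivations and an
evaluation to ℂ. It is applied to the germs of smooth complex functions in a chart
(`local_curvature`). -/

namespace PseudoSphere

/-! ### Structure equations of a frame with constant metric and shape coefficients. -/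

section AlgebraicFrames

variable {R : Type*} [CommRing R] [Algebra ℂ R] {m : ℕ}

/-- A derivation applied to each entry of a vector. -/
def derivVec (D : Derivation ℂ R R) (u : Fin m → R) : Fin m → R := fun i => D (u i)

/-- The diagonal bilinear form with constant coefficients `s`. -/
def diagForm (R : Type*) [CommRing R] [Algebra ℂ R] (s : Fin m → ℂ) :
    LinearMap.BilinForm R (Fin m → R) :=
  Matrix.toBilin' (Matrix.diagonal fun i => algebraMap ℂ R (s i))

theorem diagForm_apply (s : Fin m → ℂ) (u w : Fin m → R) :
    diagForm R s u w = ∑ i, algebraMap ℂ R (s i) * (u i * w i) := by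
  rw [diagForm, Matrix.toBilin'_apply']
  simp only [dotProduct, Matrix.mulVec_diagonal]
  exact Finset.sum_congr rfl fun i _ => by ring

theorem diagForm_comm (s : Fin m → ℂ) (u w : Fin m → R) :
    diagForm R s u w = diagForm R s w u := by
  simp only [diagForm_apply, mul_comm (u _)]

theorem derivation_diagForm (D : Derivation ℂ R R) (s : Fin m → ℂ) (u w : Fin m → R) :
    D (diagForm R s u w) = diagForm R s (derivVec D u) w + diagForm R s u (derivVec D w) := by
  simp only [diagForm_apply, map_sum, Derivation.leibniz, Derivation.map_algebraMap, derivVec,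
    ← Finset.sum_add_distrib, smul_eq_mul]
  exact Finset.sum_congr rfl fun i _ => by ring

/-- Completeness relation for a basis with invertible Gram matrix. -/
theorem diagForm_eq_sum (s : Fin m → ℂ) (F : Fin m → Fin m → R) (g g' : Matrix (Fin m) (Fin m) R)
    (hF : ∀ i j, diagForm R s (F i) (F j) = g i j) (hg : g * g' = 1) (u w : Fin m → R) :
    diagForm R s u w = ∑ i, ∑ j, diagForm R s u (F i) * g' i j * diagForm R s (F j) w := by
  set S : Matrix (Fin m) (Fin m) R := Matrix.diagonal fun i => algebraMap ℂ R (s i) with hS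
  have hB : ∀ u w, diagForm R s u w = u ⬝ᵥ S.mulVec w := fun u w => Matrix.toBilin'_apply' ..
  set Fm : Matrix (Fin m) (Fin m) R := Matrix.of F with hFm
  have h1 : Fm * (S * Fm.transpose * g') = 1 := by
    rw [← hg, ← Matrix.mul_assoc, ← Matrix.mul_assoc]
    congr 1
    ext i j
    rw [← hF, hB, Matrix.mul_assoc, Matrix.mul_apply']
    rfl
  have h2 : S * Fm.transpose * g' * Fm = 1 := mul_eq_one_comm.mp h1
  have e1 : ∀ i, diagForm R s u (F i) = Matrix.vecMul u (S * Fm.transpose) i := by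
    intro i
    rw [hB]; simp only [dotProduct, Matrix.mulVec, Matrix.vecMul, Matrix.mul_apply]; rfl
  have e2 : ∀ j, diagForm R s (F j) w = Fm.mulVec (S.mulVec w) j := fun j => hB _ _
  simp only [e1, e2]
  calc diagForm R s u w = u ⬝ᵥ (S * Fm.transpose * g' * Fm).mulVec (S.mulVec w) := by
        rw [h2, Matrix.one_mulVec, hB]
    _ = Matrix.vecMul (Matrix.vecMul u (S * Fm.transpose)) g' ⬝ᵥ Fm.mulVec (S.mulVec w) := by
        rw [← Matrix.mulVec_mulVec, Matrix.dotProduct_mulVec, Matrix.vecMul_vecMul]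
    _ = _ := by
        simp only [dotProduct, Matrix.vecMul, Finset.sum_mul]
        rw [Finset.sum_comm]

variable {D : Fin 4 → Derivation ℂ R R} {c : Fin 4 → Fin 4 → Fin 4 → R}
  {s : Fin 6 → ℂ} {x ξ : Fin 6 → R} {g a : Fin 4 → Fin 4 → R}

/-- The connection coefficients `⟨∇_i V_j, V_k⟩` of a moving frame `V_j = D_j x`. -/
def connCoeff (s : Fin 6 → ℂ) (D : Fin 4 → Derivation ℂ R R) (x : Fin 6 → R)
    (i j k : Fin 4) : R :=
  diagForm R s (derivVec (D i) (derivVec (D j) x)) (derivVec (D k) x)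

theorem derivVec_comm (hc : ∀ i j f, D i (D j f) - D j (D i f) = ∑ k, c i j k * D k f)
    (i j : Fin 4) (u : Fin 6 → R) :
    derivVec (D i) (derivVec (D j) u) - derivVec (D j) (derivVec (D i) u) =
      ∑ k, c i j k • derivVec (D k) u := by
  ext l
  simpa [derivVec] using hc i j (u l)

/-- Metric compatibility: the Gram matrix of the frame is constant, so the Leibniz rule leaves only
the two connection terms. -/
theorem connCoeff_skew
    (hg : ∀ i j, diagForm R s (derivVec (D i) x) (derivVec (D j) x) = g i j)
    (hDg : ∀ i j k, D i (g j k) = 0) (i j k : Fin 4) :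
    connCoeff s D x i j k = - connCoeff s D x i k j := by
  have h := derivation_diagForm (D i) s (derivVec (D j) x) (derivVec (D k) x)
  rw [hg, hDg, diagForm_comm s (derivVec (D j) x)] at h
  exact eq_neg_of_add_eq_zero_left h.symm

theorem connCoeff_torsion
    (hc : ∀ i j f, D i (D j f) - D j (D i f) = ∑ k, c i j k * D k f)
    (hg : ∀ i j, diagForm R s (derivVec (D i) x) (derivVec (D j) x) = g i j) (i j k : Fin 4) :
    connCoeff s D x i j k - connCoeff s D x j i k = ∑ l, c i j l * g l k := by
  have h := congrArg (fun u => diagForm R s u (derivVec (D k) x)) (derivVec_comm hc i j x)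
  simpa [connCoeff, hg] using h

theorem derivVec_neg_sum (ha : ∀ i j k, D i (a j k) = 0) (i j : Fin 4) :
    derivVec (D i) (-∑ l, a j l • derivVec (D l) x) =
      -∑ l, a j l • derivVec (D i) (derivVec (D l) x) := by
  ext t
  simp [derivVec, ha]

/-- Codazzi equation: the bracket relation is applied to `ξ` and paired with `V_k`. Because the
entries of `a` are constant, no derivatives of them appear and the equation is linear in the
connection coefficients. -/
theorem connCoeff_codazzi
    (hc : ∀ i j f, D i (D j f) - D j (D i f) = ∑ k, c i j k * D k f)
    (hg : ∀ i j, diagForm R s (derivVec (D i) x) (derivVec (D j) x) = g i j)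
    (ha : ∀ i j k, D i (a j k) = 0)
    (hξ : ∀ i, derivVec (D i) ξ = -∑ l, a i l • derivVec (D l) x) (i j k : Fin 4) :
    ∑ l, a j l * connCoeff s D x i l k - ∑ l, a i l * connCoeff s D x j l k =
      ∑ l, c i j l * ∑ m, a l m * g m k := by
  have h := congrArg (fun u => diagForm R s u (derivVec (D k) x)) (derivVec_comm hc i j ξ)
  simp only [hξ, derivVec_neg_sum ha] at h
  simp only [map_sub, map_neg, map_sum, map_smul, LinearMap.sub_apply, LinearMap.neg_apply,
    LinearMap.sum_apply, LinearMap.smul_apply, smul_eq_mul, hg, mul_neg, Finset.sum_neg_distrib]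
    at h
  simp only [connCoeff]
  linear_combination -h

theorem diagForm_derivVec_position
    (hg : ∀ i j, diagForm R s (derivVec (D i) x) (derivVec (D j) x) = g i j)
    (hx : ∀ i, diagForm R s (derivVec (D i) x) x = 0) (i j : Fin 4) :
    diagForm R s (derivVec (D i) (derivVec (D j) x)) x = - g j i := by
  have h := derivation_diagForm (D i) s (derivVec (D j) x) x
  rw [hx, map_zero, hg] at h
  linear_combination -h

theorem diagForm_derivVec_normal
    (hg : ∀ i j, diagForm R s (derivVec (D i) x) (derivVec (D j) x) = g i j)
    (hn : ∀ i, diagForm R s (derivVec (D i) x) ξ = 0)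
    (hξ : ∀ i, derivVec (D i) ξ = -∑ l, a i l • derivVec (D l) x) (i j : Fin 4) :
    diagForm R s (derivVec (D i) (derivVec (D j) x)) ξ = ∑ l, a i l * g j l := by
  have h := derivation_diagForm (D i) s (derivVec (D j) x) ξ
  rw [hn, map_zero, hξ] at h
  simp only [map_neg, map_sum, map_smul, smul_eq_mul, hg] at h
  linear_combination -h

/-- Flatness of the ambient space, paired with `V_t`. The products of second derivatives are left
unexpanded. Splitting them along `x`, `ξ` and the frame later produces the curvature of the sphere,
the shape operator terms and the products of connection coefficients. -/
theorem connCoeff_gauss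
    (hc : ∀ i j f, D i (D j f) - D j (D i f) = ∑ k, c i j k * D k f) (i j k t : Fin 4) :
    D i (connCoeff s D x j k t) -
        diagForm R s (derivVec (D j) (derivVec (D k) x)) (derivVec (D i) (derivVec (D t) x)) -
      (D j (connCoeff s D x i k t) -
        diagForm R s (derivVec (D i) (derivVec (D k) x)) (derivVec (D j) (derivVec (D t) x))) =
      ∑ l, c i j l * connCoeff s D x l k t := by
  have h := congrArg (fun u => diagForm R s u (derivVec (D t) x))
    (derivVec_comm hc i j (derivVec (D k) x))
  simp only [map_sub, map_sum, map_smul, LinearMap.sub_apply,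
    LinearMap.sum_apply, LinearMap.smul_apply, smul_eq_mul] at h
  simp only [connCoeff, derivation_diagForm] at h ⊢
  linear_combination h

theorem eq_zero_of_add_self_eq_zero {r : R} (h : r + r = 0) : r = 0 := by
  have h2 : algebraMap ℂ R (1 / 2) * 2 = 1 := by
    rw [← map_ofNat (algebraMap ℂ R) 2, ← map_mul]; norm_num
  linear_combination algebraMap ℂ R (1 / 2) * h - r * h2

theorem eq_zero_of_const_mul {l : ℂ} (hl : l ≠ 0) {r : R} (h : algebraMap ℂ R l * r = 0) :
    r = 0 := by
  have h2 : algebraMap ℂ R l⁻¹ * algebraMap ℂ R l = 1 := by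
    rw [← map_mul, inv_mul_cancel₀ hl, map_one]
  linear_combination algebraMap ℂ R l⁻¹ * h - r * h2

/-- The Gram matrix of the adapted complex frame. -/
def frameGram (R : Type*) [CommRing R] : Matrix (Fin 4) (Fin 4) R :=
  !![1, 0, 0, 0; 0, 1, 0, 0; 0, 0, 0, 1; 0, 0, 1, 0]

/-- The coefficients of the shape operator in the adapted complex frame; the rows are the images
of the frame vectors. -/
def frameShape (l₁ l₂ b : R) : Matrix (Fin 4) (Fin 4) R :=
  !![l₁, 0, 0, 0; 0, l₂, 0, 0; 0, 0, b, 0; 0, 0, 1, b]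

/-- Codazzi reduces the mixed connection coefficients to one unknown, a null Gauss equation kills
its value at the point, and a second Gauss equation then reads off the curvature. Here `V_0`, `V_1`
are unit eigenvectors, `V_2` is the null eigenvector for `b`, and `A V_3 = V_2 + b V_3`. -/
theorem frame_curvature (ev : R →ₐ[ℂ] ℂ) {ν l₁ l₂ b : ℂ} (hν : ν * ν = 1)
    (h12 : l₁ ≠ l₂) (h1b : l₁ ≠ b) (h2b : l₂ ≠ b)
    (hc : ∀ i j f, D i (D j f) - D j (D i f) = ∑ k, c i j k * D k f)
    (hg : ∀ i j, diagForm R s (derivVec (D i) x) (derivVec (D j) x) = frameGram R i j)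
    (hxx : diagForm R s x x = 1) (hξx : diagForm R s ξ x = 0)
    (hξξ : diagForm R s ξ ξ = algebraMap ℂ R ν)
    (hx : ∀ i, diagForm R s (derivVec (D i) x) x = 0)
    (hn : ∀ i, diagForm R s (derivVec (D i) x) ξ = 0)
    (hξ : ∀ i, derivVec (D i) ξ = -∑ l, frameShape (algebraMap ℂ R l₁) (algebraMap ℂ R l₂)
      (algebraMap ℂ R b) i l • derivVec (D l) x) :
    1 + ν * l₁ * l₂ = 0 := by
  set K := algebraMap ℂ R with hK
  have hDg : ∀ i j k, D i (frameGram R j k) = 0 := by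
    intro i j k; fin_cases j <;> fin_cases k <;> simp [frameGram]
  have ha : ∀ i j k, D i (frameShape (K l₁) (K l₂) (K b) j k) = 0 := by
    intro i j k; fin_cases j <;> fin_cases k <;> simp [frameShape, hK]
  have skew := connCoeff_skew hg hDg
  have tor := connCoeff_torsion hc hg
  have cod := connCoeff_codazzi hc hg ha hξ
  have px := diagForm_derivVec_position hg hx
  have pn := diagForm_derivVec_normal hg hn hξ
  have gau := connCoeff_gauss (s := s) (x := x) hc
  -- Expansion in the basis `x, ξ, V_0, …, V_3`, whose Gram matrix is its own inverse because `ν² =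
  -- 1`.
  have compl : ∀ u w, diagForm R s u w = diagForm R s u x * diagForm R s w x +
      K ν * (diagForm R s u ξ * diagForm R s w ξ) +
      diagForm R s u (derivVec (D 0) x) * diagForm R s w (derivVec (D 0) x) +
      diagForm R s u (derivVec (D 1) x) * diagForm R s w (derivVec (D 1) x) +
      diagForm R s u (derivVec (D 2) x) * diagForm R s w (derivVec (D 3) x) +
      diagForm R s u (derivVec (D 3) x) * diagForm R s w (derivVec (D 2) x) := by
    intro u w
    have hνK : K ν * K ν = 1 := by rw [hK, ← map_mul, hν, map_one]
    have h := diagForm_eq_sum s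
      ![x, ξ, derivVec (D 0) x, derivVec (D 1) x, derivVec (D 2) x, derivVec (D 3) x]
      !![1, 0, 0, 0, 0, 0; 0, K ν, 0, 0, 0, 0; 0, 0, 1, 0, 0, 0; 0, 0, 0, 1, 0, 0;
        0, 0, 0, 0, 0, 1; 0, 0, 0, 0, 1, 0]
      !![1, 0, 0, 0, 0, 0; 0, K ν, 0, 0, 0, 0; 0, 0, 1, 0, 0, 0; 0, 0, 0, 1, 0, 0;
        0, 0, 0, 0, 0, 1; 0, 0, 0, 0, 1, 0]
      (by
        intro i j
        fin_cases i <;> fin_cases j <;>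
          simp [hxx, hξx, hξξ, hx, hn, hg, frameGram, diagForm_comm s x, diagForm_comm s ξ])
      (by
        ext i j
        fin_cases i <;> fin_cases j <;> simp [Matrix.mul_apply, Fin.sum_univ_six, hνK]) u w
    rw [h]
    simp [Fin.sum_univ_six, diagForm_comm s _ w]
    ring
  simp only [Fin.sum_univ_four] at tor cod pn gau
  have G0 : ∀ i j, connCoeff s D x i j j = 0 := fun i j =>
    eq_zero_of_add_self_eq_zero (by linear_combination skew i j j)
  set L1 := K l₁
  set L2 := K l₂
  set Lb := K b
  set Γ := connCoeff s D x
  have cancel : ∀ {l l' : ℂ} {r : R}, l ≠ l' → (K l - K l') * r = 0 → r = 0 := fun h h' =>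
    eq_zero_of_const_mul (sub_ne_zero.mpr h) (by rwa [map_sub])
  -- Vanishing torsion eliminates the structure functions. Indices 2 and 3 are exchanged because
  -- `V_2` and `V_3` are dual null vectors.
  have t0 : ∀ i j, c i j 0 = Γ i j 0 - Γ j i 0 := fun i j => by
    simpa [frameGram] using (tor i j 0).symm
  have t1 : ∀ i j, c i j 1 = Γ i j 1 - Γ j i 1 := fun i j => by
    simpa [frameGram] using (tor i j 1).symm
  have t2 : ∀ i j, c i j 2 = Γ i j 3 - Γ j i 3 := fun i j => by
    simpa [frameGram] using (tor i j 3).symm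
  have t3 : ∀ i j, c i j 3 = Γ i j 2 - Γ j i 2 := fun i j => by
    simpa [frameGram] using (tor i j 2).symm
  simp only [t0, t1, t2, t3] at cod gau
  have s10 := fun i => skew i 1 0
  have s20 := fun i => skew i 2 0
  have s21 := fun i => skew i 2 1
  have s32 := fun i => skew i 3 2
  have s30 := fun i => skew i 3 0
  have s31 := fun i => skew i 3 1
  -- Most of the following Codazzi components are a nonzero difference of principal curvatures times
  -- a single coefficient; `Γ 1 1 3` needs `Γ 1 1 2 = 0` first, and `Γ 2 2 3` occurs doubled.
  have G101 : Γ 1 0 1 = 0 := cancel h12 (by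
    have h := cod 0 1 1
    simp [frameShape, frameGram, G0] at h
    linear_combination h)
  have G001 : Γ 0 0 1 = 0 := cancel h12 (by
    have h := cod 0 1 0
    simp [frameShape, frameGram, G0, s10] at h
    linear_combination -h)
  have G112 : Γ 1 1 2 = 0 := cancel h2b (by
    have h := cod 1 2 1
    simp [frameShape, frameGram, G0, s21] at h
    linear_combination -h)
  have G113 : Γ 1 1 3 = 0 := cancel h2b (by
    have h := cod 1 3 1
    simp [frameShape, frameGram, G0, s21, s31, G112] at h
    linear_combination -h)
  have G202 : Γ 2 0 2 = 0 := cancel h1b (by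
    have h := cod 0 2 2
    simp [frameShape, frameGram, G0] at h
    linear_combination h)
  have G212 : Γ 2 1 2 = 0 := cancel h2b (by
    have h := cod 1 2 2
    simp [frameShape, frameGram, G0] at h
    linear_combination h)
  have G002 : Γ 0 0 2 = 0 := cancel h1b (by
    have h := cod 0 2 0
    simp [frameShape, frameGram, G0, s20] at h
    linear_combination -h)
  have G223 : Γ 2 2 3 = 0 := eq_zero_of_add_self_eq_zero (by
    have h := cod 2 3 3
    simp [frameShape, frameGram, G0, s32] at h
    linear_combination h)
  have hw1 : (L1 - Lb) * Γ 1 0 2 = (L2 - Lb) * Γ 0 1 2 := by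
    have h := cod 0 1 2
    simp [frameShape, frameGram] at h
    linear_combination -h
  have hw2 : (L1 - L2) * Γ 2 0 1 = (L2 - Lb) * Γ 0 1 2 := by
    have h := cod 0 2 1
    simp [frameShape, frameGram, s21] at h
    linear_combination -h
  have hΓ : ∀ i j k, diagForm R s (derivVec (D i) (derivVec (D j) x)) (derivVec (D k) x) =
    Γ i j k := fun _ _ _ => rfl
  -- Gauss equation for `V_0, V_2`: since `V_2` and `A V_2` are null and proportional, only `-w Γ 2
  -- 0 1 = (w + Γ 2 0 1) Γ 1 0 2` survives, with `w = Γ 0 1 2`. Substituting `hw1` and `hw2` turns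
  -- it into `2 (l₁ - b)(l₂ - b) w² = 0`.
  have hw : Γ 0 1 2 * Γ 0 1 2 = 0 := by
    have h := gau 0 2 2 0
    rw [compl (derivVec (D 2) (derivVec (D 2) x)), compl (derivVec (D 0) (derivVec (D 2) x))] at h
    simp only [px, pn, hΓ, s20, s21, G0, G202, G212, G002, G223] at h
    simp [frameShape, frameGram] at h
    refine cancel h1b (cancel h2b (eq_zero_of_add_self_eq_zero ?_))
    linear_combination (L1 - L2) * (L1 - Lb) * h - (L1 - Lb) * Γ 0 1 2 * hw2 -
      (L1 - L2) * Γ 0 1 2 * hw1 - (L1 - L2) * Γ 2 0 1 * hw1 - (L2 - Lb) * Γ 0 1 2 * hw2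
  -- `R` need not be reduced, so `w = 0` is drawn only after evaluation. This is enough: the
  -- coefficients differentiated in the last Gauss equation already vanish in `R`.
  have ew : ev (Γ 0 1 2) = 0 := by
    have := congrArg ev hw
    rw [map_mul, map_zero] at this
    exact mul_self_eq_zero.mp this
  have eK : ∀ l, ev (K l) = l := fun l => AlgHom.commutes ev l
  have e102 : ev (Γ 1 0 2) = 0 := by
    have := congrArg ev hw1
    simp only [map_mul, map_sub, ew, L1, L2, Lb, eK, mul_zero] at this
    exact (mul_eq_zero.mp this).resolve_left (sub_ne_zero.mpr h1b)
  have e201 : ev (Γ 2 0 1) = 0 := by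
    have := congrArg ev hw2
    simp only [map_mul, map_sub, ew, L1, L2, Lb, eK, mul_zero] at this
    exact (mul_eq_zero.mp this).resolve_left (sub_ne_zero.mpr h12)
  have h := gau 0 1 1 0
  rw [compl (derivVec (D 1) (derivVec (D 1) x)), compl (derivVec (D 0) (derivVec (D 1) x))] at h
  simp only [px, pn, hΓ, s10, G0, G101, G001, G112, G113] at h
  have h := congrArg ev h
  simp [frameShape, frameGram, ew, e102, e201, L1, L2, eK] at h
  linear_combination -h

end AlgebraicFrames
-- Construction of the adapted frame and change from coordinate fields to it.
section AdaptedFrames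

variable {R : Type*} [CommRing R] [Algebra ℂ R]

theorem eq_zero_of_distinct_eigenvalues {l l' : ℂ} (hl : l ≠ l') {r : R}
    (h : algebraMap ℂ R l * r = algebraMap ℂ R l' * r) : r = 0 :=
  eq_zero_of_const_mul (sub_ne_zero.mpr hl) (by rw [map_sub]; linear_combination h)

/-- An adapted frame for a self-adjoint operator annihilated by `(t - l₁) (t - l₂) (t - b)²`. -/
theorem exists_adapted_frame {V : Type*} [AddCommGroup V] [Module R V] (A : V →ₗ[R] V)
    (q : LinearMap.BilinForm R V) (hq : ∀ u w, q u w = q w u)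
    (hA : ∀ u w, q (A u) w = q u (A w)) (ev : R →ₐ[ℂ] ℂ)
    (hsq : ∀ r, ev r ≠ 0 → ∃ t, t * t * r = 1)
    {l₁ l₂ b : ℂ} (h12 : l₁ ≠ l₂) (h1b : l₁ ≠ b) (h2b : l₂ ≠ b)
    {T : ℂ → V →ₗ[R] V} (hT : ∀ l u, T l u = A u - algebraMap ℂ R l • u)
    (hP : ∀ u, T l₁ (T l₂ (T b (T b u))) = 0) (v₁ v₂ v₄ : V)
    (hv₁ : ev (q (T l₂ (T b (T b v₁))) (T l₂ (T b (T b v₁)))) ≠ 0)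
    (hv₂ : ev (q (T l₁ (T b (T b v₂))) (T l₁ (T b (T b v₂)))) ≠ 0)
    (hv₄ : ev (q (T b (T l₁ (T l₂ v₄))) (T l₁ (T l₂ v₄))) ≠ 0) :
    ∃ E : Fin 4 → V,
      (∀ i, A (E i) = ∑ l, frameShape (algebraMap ℂ R l₁) (algebraMap ℂ R l₂)
        (algebraMap ℂ R b) i l • E l) ∧
      ∀ i j, q (E i) (E j) = frameGram R i j := by
  have hTA : ∀ l u, A u = algebraMap ℂ R l • u + T l u := fun l u => by rw [hT]; abel
  have hcomm : ∀ l l' u, T l (T l' u) = T l' (T l u) := by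
    intro l l' u
    simp only [hT, map_sub, map_smul]
    module
  obtain ⟨t₁, ht₁⟩ := hsq _ hv₁
  obtain ⟨t₂, ht₂⟩ := hsq _ hv₂
  obtain ⟨t₄, ht₄⟩ := hsq _ hv₄
  -- Each vector is an image under the complementary factors of the annihilating polynomial, hence
  -- lies in the corresponding generalized eigenspace.
  set e₁ := T l₂ (T b (T b v₁)) with he₁
  set e₂ := T l₁ (T b (T b v₂)) with he₂
  set e₄ := T l₁ (T l₂ v₄) with he₄
  set e₃ := T b e₄ with he₃
  have a₁ : A e₁ = algebraMap ℂ R l₁ • e₁ := by rw [hTA l₁, hP, add_zero]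
  have a₂ : A e₂ = algebraMap ℂ R l₂ • e₂ := by rw [hTA l₂, he₂, hcomm l₂ l₁, hP, add_zero]
  have a₄ : A e₄ = algebraMap ℂ R b • e₄ + e₃ := hTA b e₄
  have a₃ : A e₃ = algebraMap ℂ R b • e₃ := by
    rw [hTA b e₃, he₃, he₄, hcomm b l₁, hcomm b l₂, hcomm b l₁, hcomm b l₂, hP, add_zero]
  have q12 : q e₁ e₂ = 0 := eq_zero_of_distinct_eigenvalues h12 (by
    simpa [a₁, a₂, -algebraMap_smul] using hA e₁ e₂)
  have q13 : q e₁ e₃ = 0 := eq_zero_of_distinct_eigenvalues h1b (by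
    simpa [a₁, a₃, -algebraMap_smul] using hA e₁ e₃)
  have q23 : q e₂ e₃ = 0 := eq_zero_of_distinct_eigenvalues h2b (by
    simpa [a₂, a₃, -algebraMap_smul] using hA e₂ e₃)
  have q14 : q e₁ e₄ = 0 := eq_zero_of_distinct_eigenvalues h1b (by
    simpa [a₁, a₄, q13, -algebraMap_smul] using hA e₁ e₄)
  have q24 : q e₂ e₄ = 0 := eq_zero_of_distinct_eigenvalues h2b (by
    simpa [a₂, a₄, q23, -algebraMap_smul] using hA e₂ e₄)
  have q33 : q e₃ e₃ = 0 := by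
    have h := hA e₃ e₄
    simp only [a₃, a₄, map_add, map_smul, LinearMap.smul_apply, smul_eq_mul] at h
    linear_combination -h
  have i2 : algebraMap ℂ R (1 / 2) + algebraMap ℂ R (1 / 2) = 1 := by
    rw [← map_add]; norm_num
  -- Half the square of the rescaled `e₄`: subtracting this multiple of the null vector `t₄ • e₃`
  -- makes the last frame vector null and keeps the Jordan relation.
  set z := algebraMap ℂ R (1 / 2) * (t₄ * t₄ * q e₄ e₄) with hz
  refine ⟨![t₁ • e₁, t₂ • e₂, t₄ • e₃, t₄ • e₄ - (z * t₄) • e₃], ?_, ?_⟩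
  · intro i
    fin_cases i
    · simp [Fin.sum_univ_four, frameShape, a₁, smul_comm t₁]
    · simp [Fin.sum_univ_four, frameShape, a₂, smul_comm t₂]
    · simp [Fin.sum_univ_four, frameShape, a₃, smul_comm t₄]
    · simp [Fin.sum_univ_four, frameShape, a₃, a₄]
      module
  · have q34 : t₄ * (t₄ * q e₃ e₄) = 1 := by linear_combination ht₄
    have q44 : q (t₄ • e₄ - (z * t₄) • e₃) (t₄ • e₄ - (z * t₄) • e₃) = 0 := by
      simp only [map_sub, map_smul, LinearMap.smul_apply, LinearMap.sub_apply, smul_eq_mul, q33,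
        hq e₄ e₃]
      linear_combination -2 * z * q34 - t₄ * t₄ * q e₄ e₄ * i2
    intro i j
    fin_cases i <;> fin_cases j <;>
      simp [frameGram, q12, q13, q14, q23, q24, q33, hq e₂ e₁, hq e₃ e₁, hq e₄ e₁, hq e₃ e₂,
        hq e₄ e₂, hq e₄ e₃, q34]
    · linear_combination ht₁
    · linear_combination ht₂
    · simpa [q33, hq e₄ e₃] using q44

/-- The frame derivations `D i = ∑ E i j • d j` no longer commute, but their brackets close over `R`
because `E` is invertible. This supplies the structure functions needed by `frame_curvature`. -/
theorem curvature_of_coordinates {d : Fin 4 → Derivation ℂ R R}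
    (hcomm : ∀ i j f, d i (d j f) = d j (d i f)) (ev : R →ₐ[ℂ] ℂ)
    {s : Fin 6 → ℂ} {x ξ : Fin 6 → R} {A G : Matrix (Fin 4) (Fin 4) R} {E : Fin 4 → Fin 4 → R}
    {ν l₁ l₂ b : ℂ} (hν : ν * ν = 1) (h12 : l₁ ≠ l₂) (h1b : l₁ ≠ b) (h2b : l₂ ≠ b)
    (hG : ∀ i j, diagForm R s (derivVec (d i) x) (derivVec (d j) x) = G i j)
    (hxx : diagForm R s x x = 1) (hξx : diagForm R s ξ x = 0)
    (hξξ : diagForm R s ξ ξ = algebraMap ℂ R ν)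
    (hx : ∀ i, diagForm R s (derivVec (d i) x) x = 0)
    (hn : ∀ i, diagForm R s (derivVec (d i) x) ξ = 0)
    (hξ : ∀ j, derivVec (d j) ξ = -∑ k, A k j • derivVec (d k) x)
    (hE : ∀ i, A.mulVec (E i) = ∑ l, frameShape (algebraMap ℂ R l₁) (algebraMap ℂ R l₂)
        (algebraMap ℂ R b) i l • E l)
    (hEG : ∀ i j, Matrix.toBilin' G (E i) (E j) = frameGram R i j) :
    1 + ν * l₁ * l₂ = 0 := by
  set Em : Matrix (Fin 4) (Fin 4) R := Matrix.of E with hEm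
  -- `E G Eᵀ = frameGram` and `frameGram` squares to 1, which gives the inverse of `E` explicitly.
  have hE1 : Em * (G * Em.transpose * frameGram R) = 1 := by
    have h1 : Em * (G * Em.transpose) = frameGram R := by
      ext i j
      rw [← hEG, Matrix.toBilin'_apply', ← Matrix.mul_assoc, Matrix.mul_assoc, Matrix.mul_apply']
      rfl
    rw [← Matrix.mul_assoc, h1]
    ext i j
    fin_cases i <;> fin_cases j <;> simp [frameGram, Matrix.mul_apply, Fin.sum_univ_four]
  have hE2 := mul_eq_one_comm.mp hE1
  set Ei := G * Em.transpose * frameGram R with hEi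
  set D : Fin 4 → Derivation ℂ R R := fun i => ∑ j, E i j • d j with hD
  have hDf : ∀ i f, D i f = ∑ j, E i j * d j f := by
    intro i f
    simp [hD, Fin.sum_univ_four]
  have hDv : ∀ i (u : Fin 6 → R), derivVec (D i) u = ∑ j, E i j • derivVec (d j) u := by
    intro i u; ext t; simp [derivVec, hDf]
  have hinv : ∀ j f, d j f = ∑ k, Ei j k * D k f := by
    intro j f
    have h1 : (fun j => d j f) = Ei.mulVec (Em.mulVec fun j => d j f) := by
      rw [Matrix.mulVec_mulVec, hE2, Matrix.one_mulVec]
    have h2 : (Em.mulVec fun j => d j f) = fun k => D k f := by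
      ext k; rw [hDf]; rfl
    rw [h2] at h1
    exact congrFun h1 j
  refine frame_curvature (D := D)
    (c := fun i j k => ∑ t, (D i (E j t) - D j (E i t)) * Ei t k) ev hν h12 h1b h2b
    ?_ ?_ hxx hξx hξξ ?_ ?_ ?_
  · intro i j f
    have h1 : ∀ i j, D i (D j f) = ∑ t, D i (E j t) * d t f +
        ∑ t, ∑ r, E j t * (E i r * d r (d t f)) := by
      intro i j
      rw [hDf j, map_sum, ← Finset.sum_add_distrib]
      refine Finset.sum_congr rfl fun t _ => ?_
      rw [Derivation.leibniz, hDf i (d t f), smul_eq_mul, smul_eq_mul, Finset.mul_sum]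
      ring
    have h2 : ∑ t, ∑ r, E j t * (E i r * d r (d t f)) =
        ∑ t, ∑ r, E i t * (E j r * d r (d t f)) := by
      rw [Finset.sum_comm]
      refine Finset.sum_congr rfl fun t _ => Finset.sum_congr rfl fun r _ => ?_
      rw [hcomm]; ring
    rw [h1 i j, h1 j i, h2, add_sub_add_right_eq_sub, ← Finset.sum_sub_distrib]
    simp only [Finset.sum_mul]
    rw [Finset.sum_comm]
    refine Finset.sum_congr rfl fun t _ => ?_
    rw [← sub_mul, hinv t f, Finset.mul_sum]
    exact Finset.sum_congr rfl fun k _ => by ring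
  · intro i j
    rw [← hEG, Matrix.toBilin'_apply]
    simp only [hDv, map_sum, map_smul, LinearMap.sum_apply, LinearMap.smul_apply, smul_eq_mul, hG,
      Finset.mul_sum]
    rw [Finset.sum_comm]
    exact Finset.sum_congr rfl fun k _ => Finset.sum_congr rfl fun t _ => by ring
  · intro i; simp [hDv, hx]
  · intro i; simp [hDv, hn]
  · intro i
    simp only [hDv, hξ]
    have h1 : ∀ k, ∑ j, A k j * E i j = ∑ l, frameShape (algebraMap ℂ R l₁) (algebraMap ℂ R l₂)
        (algebraMap ℂ R b) i l * E l k := by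
      intro k
      have := congrFun (hE i) k
      simpa [Matrix.mulVec, dotProduct] using this
    simp only [smul_neg, Finset.sum_neg_distrib, Finset.smul_sum, smul_smul]
    congr 1
    rw [Finset.sum_comm]
    conv_rhs => rw [Finset.sum_comm]
    refine Finset.sum_congr rfl fun k _ => ?_
    rw [← Finset.sum_smul, ← Finset.sum_smul, ← h1]
    congr 1
    exact Finset.sum_congr rfl fun j _ => by ring

/-- The curvature identity for a hypersurface in coordinates, over a ring of functions that contains
square roots of its invertible elements. -/
theorem curvature_of_petrovTypeIV {d : Fin 4 → Derivation ℂ R R}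
    (hcomm : ∀ i j f, d i (d j f) = d j (d i f)) (ev : R →ₐ[ℂ] ℂ)
    (hsq : ∀ r, ev r ≠ 0 → ∃ t, t * t * r = 1)
    {s : Fin 6 → ℂ} {x ξ : Fin 6 → R} {A : Matrix (Fin 4) (Fin 4) R}
    {ν : ℂ} (hν : ν * ν = 1) {α β b ε : ℝ} (hβ : β ≠ 0) (hε : ε ≠ 0)
    (hxx : diagForm R s x x = 1) (hξx : diagForm R s ξ x = 0)
    (hξξ : diagForm R s ξ ξ = algebraMap ℂ R ν)
    (hn : ∀ i, diagForm R s (derivVec (d i) x) ξ = 0)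
    (hξ : ∀ j, derivVec (d j) ξ = -∑ k, A k j • derivVec (d k) x)
    (hP : (A - algebraMap ℂ R (α + β * Complex.I) • 1) *
      ((A - algebraMap ℂ R (α - β * Complex.I) • 1) *
      ((A - algebraMap ℂ R b • 1) * (A - algebraMap ℂ R b • 1))) = 0)
    (evA : ∀ i j, ev (A i j) = (!![α, -β, 0, 0; β, α, 0, 0; 0, 0, b, 1; 0, 0, 0, b] i j : ℝ))
    (evG : ∀ i j, ev (diagForm R s (derivVec (d i) x) (derivVec (d j) x)) =
      (!![-1, 0, 0, 0; 0, 1, 0, 0; 0, 0, 0, ε; 0, 0, ε, 0] i j : ℝ)) :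
    1 + ν * (α ^ 2 + β ^ 2) = 0 := by
  have hβ' : (β : ℂ) ≠ 0 := Complex.ofReal_ne_zero.mpr hβ
  have hε' : (ε : ℂ) ≠ 0 := Complex.ofReal_ne_zero.mpr hε
  set l₁ : ℂ := α + β * Complex.I with hl₁
  set l₂ : ℂ := α - β * Complex.I with hl₂
  have h12 : l₁ ≠ l₂ := fun h => hβ (by simpa [hl₁, hl₂, self_eq_neg] using congrArg Complex.im h)
  have h1b : l₁ ≠ b := fun h => hβ (by simpa [hl₁] using congrArg Complex.im h)
  have h2b : l₂ ≠ b := fun h => hβ (by simpa [hl₂] using congrArg Complex.im h)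
  set G : Matrix (Fin 4) (Fin 4) R :=
    Matrix.of fun i j => diagForm R s (derivVec (d i) x) (derivVec (d j) x) with hGdef
  have hG : ∀ i j, diagForm R s (derivVec (d i) x) (derivVec (d j) x) = G i j := fun _ _ => rfl
  have hx : ∀ i, diagForm R s (derivVec (d i) x) x = 0 := by
    intro i
    have h := derivation_diagForm (d i) s x x
    rw [hxx, Derivation.map_one_eq_zero, diagForm_comm s x] at h
    exact eq_zero_of_add_self_eq_zero h.symm
  have hGs : ∀ i j, G i j = G j i := fun i j => diagForm_comm s _ _
  -- Self-adjointness of `A`: both sides are the normal components of second derivatives of `x`, and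
  -- the coordinate derivations commute.
  have hGA : ∀ i j, ∑ k, G i k * A k j = ∑ k, G j k * A k i := by
    have h : ∀ i j, ∑ k, G i k * A k j =
        diagForm R s (derivVec (d j) (derivVec (d i) x)) ξ := by
      intro i j
      have h := derivation_diagForm (d j) s (derivVec (d i) x) ξ
      rw [hn, map_zero, hξ] at h
      simp only [map_neg, map_sum, map_smul, smul_eq_mul, hG, mul_comm (A _ _)] at h
      linear_combination h
    intro i j
    rw [h, h]
    congr 2
    ext t
    exact hcomm j i (x t)
  set q := Matrix.toBilin' G with hqdef
  have hqa : ∀ u w, q u w = ∑ i, ∑ j, u i * G i j * w j := fun u w => Matrix.toBilin'_apply G u w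
  have hq : ∀ u w, q u w = q w u := by
    intro u w
    rw [hqa, hqa, Finset.sum_comm]
    exact Finset.sum_congr rfl fun i _ => Finset.sum_congr rfl fun j _ => by rw [hGs]; ring
  have hAq : ∀ u w, q (A.mulVec u) w = q u (A.mulVec w) := by
    have h : ∀ u w, q u (A.mulVec w) = ∑ i, ∑ j, u i * w j * ∑ k, G i k * A k j := by
      intro u w
      rw [hqa]
      refine Finset.sum_congr rfl fun i _ => ?_
      simp only [Matrix.mulVec, dotProduct, Finset.mul_sum]
      rw [Finset.sum_comm]
      exact Finset.sum_congr rfl fun k _ => Finset.sum_congr rfl fun j _ => by ring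
    intro u w
    rw [hq, h, h, Finset.sum_comm]
    exact Finset.sum_congr rfl fun i _ => Finset.sum_congr rfl fun j _ => by rw [hGA]; ring
  set T : ℂ → (Fin 4 → R) →ₗ[R] (Fin 4 → R) :=
    fun l => Matrix.toLin' (A - algebraMap ℂ R l • 1) with hTdef
  have hT : ∀ l u, T l u = Matrix.toLin' A u - algebraMap ℂ R l • u := by
    intro l u
    simp only [hTdef, Matrix.toLin'_apply, Matrix.sub_mulVec, Matrix.smul_mulVec,
      Matrix.one_mulVec]
  have hTe : ∀ l u i, ev (T l u i) = (∑ j,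
      ((!![α, -β, 0, 0; β, α, 0, 0; 0, 0, b, 1; 0, 0, 0, b] i j : ℝ) : ℂ) * ev (u j)) -
      l * ev (u i) := by
    intro l u i
    rw [hT, Pi.sub_apply, map_sub, Pi.smul_apply, smul_eq_mul, map_mul, AlgHom.commutes,
      Matrix.toLin'_apply, Matrix.mulVec, dotProduct, map_sum]
    simp only [map_mul, evA]
    rfl
  have hqe : ∀ u w, ev (q u w) = -(ev (u 0) * ev (w 0)) + ev (u 1) * ev (w 1) +
      ε * (ev (u 2) * ev (w 3)) + ε * (ev (u 3) * ev (w 2)) := by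
    intro u w
    rw [hqa]
    simp only [map_sum, map_mul, ← hG, evG]
    simp [Fin.sum_univ_four]
    ring
  have eK : ∀ l, ev (algebraMap ℂ R l) = l := fun l => AlgHom.commutes ev l
  have hI : Complex.I * Complex.I = -1 := Complex.I_mul_I
  obtain ⟨E, hE, hEG⟩ := exists_adapted_frame (Matrix.toLin' A) q hq hAq ev hsq h12 h1b h2b
    hT (fun u => by
      have := congrArg (fun M => Matrix.toLin' M u) hP
      simpa only [Matrix.toLin'_mul, LinearMap.comp_apply, map_zero, LinearMap.zero_apply]
        using this)
    -- Constant vectors which at the base point are eigenvectors for `l₁` and `l₂`, of square `-2`,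
    -- and the top of the Jordan chain for `b`. The required nonvanishing is therefore a product of
    -- differences of eigenvalues.
    ![1, algebraMap ℂ R (-Complex.I), 0, 0] ![1, algebraMap ℂ R Complex.I, 0, 0] ![0, 0, 0, 1]
    (by
      have h : ∀ l (c : ℂ) u, ev (u 0) = c → ev (u 1) = -Complex.I * c → ev (u 2) = 0 →
          ev (u 3) = 0 → ev (T l u 0) = (l₁ - l) * c ∧ ev (T l u 1) = -Complex.I * ((l₁ - l) * c) ∧
          ev (T l u 2) = 0 ∧ ev (T l u 3) = 0 := by
        intro l c u h0 h1 h2 h3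
        simp [hTe, Fin.sum_univ_four, h0, h1, h2, h3]
        constructor
        · ring
        · linear_combination (β * c) * hI
      obtain ⟨a0, a1, a2, a3⟩ := h b 1 ![1, algebraMap ℂ R (-Complex.I), 0, 0] (by simp)
        (by simp [-map_neg, eK]) (by simp) (by simp)
      obtain ⟨b0, b1, b2, b3⟩ := h b _ _ a0 a1 a2 a3
      obtain ⟨c0, c1, c2, c3⟩ := h l₂ _ _ b0 b1 b2 b3
      rw [hqe, c0, c1, c2, c3]
      have : (l₁ - l₂) * ((l₁ - b) * ((l₁ - b) * 1)) ≠ 0 := by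
        simp [sub_ne_zero, h12, h1b]
      intro h
      apply mul_ne_zero this this
      linear_combination -h / 2 + ((l₁ - l₂) * ((l₁ - b) * ((l₁ - b) * 1))) ^ 2 / 2 * hI)
    (by
      have h : ∀ l (c : ℂ) u, ev (u 0) = c → ev (u 1) = Complex.I * c → ev (u 2) = 0 →
          ev (u 3) = 0 → ev (T l u 0) = (l₂ - l) * c ∧ ev (T l u 1) = Complex.I * ((l₂ - l) * c) ∧
          ev (T l u 2) = 0 ∧ ev (T l u 3) = 0 := by
        intro l c u h0 h1 h2 h3
        simp [hTe, Fin.sum_univ_four, h0, h1, h2, h3]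
        constructor
        · ring
        · linear_combination (β * c) * hI
      obtain ⟨a0, a1, a2, a3⟩ := h b 1 ![1, algebraMap ℂ R Complex.I, 0, 0] (by simp)
        (by simp [eK]) (by simp) (by simp)
      obtain ⟨b0, b1, b2, b3⟩ := h b _ _ a0 a1 a2 a3
      obtain ⟨c0, c1, c2, c3⟩ := h l₁ _ _ b0 b1 b2 b3
      rw [hqe, c0, c1, c2, c3]
      have : (l₂ - l₁) * ((l₂ - b) * ((l₂ - b) * 1)) ≠ 0 := by
        simp [sub_ne_zero, h12.symm, h2b]
      intro h
      apply mul_ne_zero this this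
      linear_combination -h / 2 + ((l₂ - l₁) * ((l₂ - b) * ((l₂ - b) * 1))) ^ 2 / 2 * hI)
    (by
      have h : (b - l₁) * (b - l₂) ≠ 0 :=
        mul_ne_zero (sub_ne_zero.mpr h1b.symm) (sub_ne_zero.mpr h2b.symm)
      rw [hqe]
      simp [hTe, Fin.sum_univ_four, hε', sub_eq_zero, h1b.symm, h2b.symm])
  have h := curvature_of_coordinates hcomm ev hν h12 h1b h2b hG hxx hξx hξξ hx hn hξ hE hEG
  linear_combination h + ν * β ^ 2 * hI

end AdaptedFrames
-- The differential algebra of germs of smooth complex functions.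
section SmoothGerms

open Filter Topology

/-- Germs of functions form an algebra over the constants. -/
instance germAlgebra {X : Type*} (l : Filter X) : Algebra ℂ (Germ l ℂ) :=
  Algebra.ofModule
    (fun r x y => by
      induction x using Germ.inductionOn
      induction y using Germ.inductionOn
      rw [← Germ.coe_smul, ← Germ.coe_mul, ← Germ.coe_mul, ← Germ.coe_smul, smul_mul_assoc])
    (fun r x y => by
      induction x using Germ.inductionOn
      induction y using Germ.inductionOn
      rw [← Germ.coe_smul, ← Germ.coe_mul, ← Germ.coe_mul, ← Germ.coe_smul, mul_smul_comm])

theorem algebraMap_germ {X : Type*} (l : Filter X) (c : ℂ) :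
    algebraMap ℂ (Germ l ℂ) c = ((fun _ => c : X → ℂ) : Germ l ℂ) := by
  rw [Algebra.algebraMap_eq_smul_one, ← Germ.coe_one, ← Germ.coe_smul]
  congr 1
  ext
  simp

variable {V : Type*} [NormedAddCommGroup V] [NormedSpace ℝ V]

/-- The algebra of germs at `x₀` of smooth complex-valued functions. -/
def smoothGerms (x₀ : V) : Subalgebra ℂ (Germ (𝓝 x₀) ℂ) where
  carrier := {φ | ∃ f : V → ℂ, ContDiffAt ℝ ∞ f x₀ ∧ φ = f}
  mul_mem' := by
    rintro _ _ ⟨f, hf, rfl⟩ ⟨g, hg, rfl⟩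
    exact ⟨f * g, hf.mul hg, rfl⟩
  add_mem' := by
    rintro _ _ ⟨f, hf, rfl⟩ ⟨g, hg, rfl⟩
    exact ⟨f + g, hf.add hg, rfl⟩
  algebraMap_mem' c := ⟨fun _ => c, contDiffAt_const, algebraMap_germ _ c⟩

variable {x₀ : V}

/-- The germ of a smooth function. -/
def smoothGerm (f : V → ℂ) (hf : ContDiffAt ℝ ∞ f x₀) : smoothGerms x₀ := ⟨f, f, hf, rfl⟩

theorem exists_smoothGerm (φ : smoothGerms x₀) : ∃ f hf, φ = smoothGerm f hf := by
  obtain ⟨_, f, hf, rfl⟩ := φ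
  exact ⟨f, hf, rfl⟩

theorem smoothGerm_eq {f g : V → ℂ} {hf : ContDiffAt ℝ ∞ f x₀} {hg : ContDiffAt ℝ ∞ g x₀} :
    smoothGerm f hf = smoothGerm g hg ↔ ∀ᶠ y in 𝓝 x₀, f y = g y :=
  Subtype.ext_iff.trans Germ.coe_eq

theorem smoothGerm_add {f g : V → ℂ} (hf : ContDiffAt ℝ ∞ f x₀) (hg : ContDiffAt ℝ ∞ g x₀) :
    smoothGerm f hf + smoothGerm g hg = smoothGerm (fun y => f y + g y) (hf.add hg) := rfl

theorem smoothGerm_mul {f g : V → ℂ} (hf : ContDiffAt ℝ ∞ f x₀) (hg : ContDiffAt ℝ ∞ g x₀) :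
    smoothGerm f hf * smoothGerm g hg = smoothGerm (fun y => f y * g y) (hf.mul hg) := rfl

theorem algebraMap_smoothGerms (c : ℂ) :
    algebraMap ℂ (smoothGerms x₀) c = smoothGerm (fun _ => c) contDiffAt_const :=
  Subtype.ext (algebraMap_germ _ c)

/-- Evaluation of a smooth germ at its base point. -/
def smoothGermEval (x₀ : V) : smoothGerms x₀ →ₐ[ℂ] ℂ where
  toRingHom := (Germ.valueRingHom (X := V) (x := x₀)).comp (smoothGerms x₀).val.toRingHom
  commutes' c := by
    rw [algebraMap_smoothGerms]; rfl

theorem smoothGermEval_mk (f : V → ℂ) (hf : ContDiffAt ℝ ∞ f x₀) :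
    smoothGermEval x₀ (smoothGerm f hf) = f x₀ := rfl

/-- Near the base point `f / f x₀` is close to 1, where the principal logarithm is smooth. A
constant root of `(f x₀)⁻¹` corrects the value there. -/
theorem exists_sqrt_inv (φ : smoothGerms x₀) (h : smoothGermEval x₀ φ ≠ 0) :
    ∃ t, t * t * φ = 1 := by
  obtain ⟨f, hf, rfl⟩ := exists_smoothGerm φ
  rw [smoothGermEval_mk] at h
  have h1 : f x₀ / f x₀ ∈ Complex.slitPlane := by rw [div_self h]; exact Complex.one_mem_slitPlane
  obtain ⟨r, hr⟩ := IsAlgClosed.exists_pow_nat_eq (f x₀)⁻¹ (n := 2) two_pos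
  have hfd : ContDiffAt ℝ ∞ (fun y => f y / f x₀) x₀ := hf.div_const _
  have hl : ContDiffAt ℝ ∞ Complex.log (f x₀ / f x₀) :=
    (Complex.contDiffAt_log h1 (n := ∞)).restrict_scalars ℝ
  have hlog : ContDiffAt ℝ ∞ (fun y => Complex.log (f y / f x₀)) x₀ :=
    hl.comp (f := fun y => f y / f x₀) x₀ hfd
  have ht : ContDiffAt ℝ ∞ (fun y => r * Complex.exp (-Complex.log (f y / f x₀) / 2)) x₀ :=
    contDiffAt_const.mul ((hlog.neg.div_const 2).cexp)
  refine ⟨smoothGerm _ ht, ?_⟩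
  rw [smoothGerm_mul, smoothGerm_mul, ← map_one (algebraMap ℂ (smoothGerms x₀)),
    algebraMap_smoothGerms, smoothGerm_eq]
  filter_upwards [hf.continuousAt.eventually_ne h] with y hy
  have h2 : Complex.exp (-Complex.log (f y / f x₀) / 2) *
      Complex.exp (-Complex.log (f y / f x₀) / 2) = f x₀ / f y := by
    rw [← Complex.exp_add, ← add_div, ← two_mul, mul_div_cancel_left₀ _ two_ne_zero,
      Complex.exp_neg, Complex.exp_log (div_ne_zero hy h), inv_div]
  calc _ = (r * r) * (Complex.exp (-Complex.log (f y / f x₀) / 2) *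
      Complex.exp (-Complex.log (f y / f x₀) / 2)) * f y := by ring
    _ = 1 := by rw [h2, ← pow_two, hr]; field_simp

theorem contDiffAt_fderiv_apply {F : Type*} [NormedAddCommGroup F] [NormedSpace ℝ F] {f : V → F}
    (hf : ContDiffAt ℝ ∞ f x₀) (w : V) : ContDiffAt ℝ ∞ (fun y => fderiv ℝ f y w) x₀ :=
  (hf.fderiv_right (m := ∞) (by simp)).clm_apply contDiffAt_const

theorem eventually_differentiableAt {F : Type*} [NormedAddCommGroup F] [NormedSpace ℝ F]
    {f : V → F} (hf : ContDiffAt ℝ ∞ f x₀) : ∀ᶠ y in 𝓝 x₀, DifferentiableAt ℝ f y := by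
  have h1 : ContDiffAt ℝ 1 f x₀ := hf.of_le (by simp)
  filter_upwards [h1.eventually (by simp)] with y hy
  exact hy.differentiableAt (by simp)

/-- The directional derivative of germs of functions. -/
noncomputable def germDeriv (x₀ w : V) : Germ (𝓝 x₀) ℂ → Germ (𝓝 x₀) ℂ :=
  Germ.map' (fun f y => fderiv ℝ f y w) fun _ _ h => by
    filter_upwards [h.fderiv (𝕜 := ℝ)] with y hy
    rw [hy]

/-- The directional derivative, as a derivation of the algebra of smooth germs. -/
noncomputable def smoothGermDeriv (x₀ w : V) : Derivation ℂ (smoothGerms x₀) (smoothGerms x₀) :=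
  Derivation.mk'
    { toFun := fun φ => ⟨germDeriv x₀ w φ, by
        obtain ⟨_, f, hf, rfl⟩ := φ
        exact ⟨_, contDiffAt_fderiv_apply hf w, rfl⟩⟩
      map_add' := fun φ ψ => by
        obtain ⟨f, hf, rfl⟩ := exists_smoothGerm φ
        obtain ⟨g, hg, rfl⟩ := exists_smoothGerm ψ
        refine Subtype.ext (Germ.coe_eq.mpr ?_)
        filter_upwards [eventually_differentiableAt hf, eventually_differentiableAt hg]
          with y hfy hgy
        rw [fderiv_fun_add hfy hgy]
        rfl
      map_smul' := fun c φ => by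
        obtain ⟨f, hf, rfl⟩ := exists_smoothGerm φ
        refine Subtype.ext (Germ.coe_eq.mpr ?_)
        filter_upwards [eventually_differentiableAt hf] with y hfy
        change fderiv ℝ (fun y => c • f y) y w = c • fderiv ℝ f y w
        rw [fderiv_fun_const_smul hfy]
        rfl }
    fun φ ψ => by
      obtain ⟨f, hf, rfl⟩ := exists_smoothGerm φ
      obtain ⟨g, hg, rfl⟩ := exists_smoothGerm ψ
      refine Subtype.ext (Germ.coe_eq.mpr ?_)
      filter_upwards [eventually_differentiableAt hf, eventually_differentiableAt hg]
        with y hfy hgy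
      rw [fderiv_fun_mul hfy hgy]
      rfl

theorem smoothGermDeriv_mk (f : V → ℂ) (hf : ContDiffAt ℝ ∞ f x₀) (w : V) :
    smoothGermDeriv x₀ w (smoothGerm f hf) =
      smoothGerm (fun y => fderiv ℝ f y w) (contDiffAt_fderiv_apply hf w) := rfl

/-- Symmetry of the second derivative at all points near `x₀`. -/
theorem smoothGermDeriv_comm (v w : V) (φ : smoothGerms x₀) :
    smoothGermDeriv x₀ v (smoothGermDeriv x₀ w φ) =
      smoothGermDeriv x₀ w (smoothGermDeriv x₀ v φ) := by
  obtain ⟨f, hf, rfl⟩ := exists_smoothGerm φ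
  simp only [smoothGermDeriv_mk, smoothGerm_eq]
  have h2 : ContDiffAt ℝ 2 f x₀ := hf.of_le ENat.LEInfty.out
  have h3 : ContDiffAt ℝ ∞ (fderiv ℝ f) x₀ := hf.fderiv_right (by simp)
  filter_upwards [h2.eventually (by simp), eventually_differentiableAt h3] with y hy hy'
  have h := hy.isSymmSndFDerivAt (by simp) v w
  rw [fderiv_clm_apply hy' (differentiableAt_const _),
    fderiv_clm_apply hy' (differentiableAt_const _)]
  simpa using h

end SmoothGerms
-- Translation of a hypersurface in coordinates into germs.
section LocalCurvature

open Filter Topology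

variable {V : Type*} [NormedAddCommGroup V] [NormedSpace ℝ V] {x₀ : V}

theorem smoothGerm_sum {ι : Type*} (t : Finset ι) (f : ι → V → ℂ)
    (hf : ∀ i, ContDiffAt ℝ ∞ (f i) x₀) :
    ∑ i ∈ t, smoothGerm (f i) (hf i) =
      smoothGerm (fun y => ∑ i ∈ t, f i y) (ContDiffAt.sum fun i _ => hf i) := by
  classical
  induction t using Finset.induction_on with
  | empty =>
    simp only [Finset.sum_empty]
    rw [← map_zero (algebraMap ℂ (smoothGerms x₀)), algebraMap_smoothGerms]
  | insert i t hi ih =>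
    simp only [Finset.sum_insert hi]
    rw [ih, smoothGerm_add]

/-- The matrix of germs of a matrix-valued function. -/
def matrixGerm {n : ℕ} (M : V → Matrix (Fin n) (Fin n) ℂ)
    (hM : ∀ i j, ContDiffAt ℝ ∞ (fun y => M y i j) x₀) : Matrix (Fin n) (Fin n) (smoothGerms x₀) :=
  Matrix.of fun i j => smoothGerm (fun y => M y i j) (hM i j)

theorem contDiffAt_matrix_mul {n : ℕ} {M N : V → Matrix (Fin n) (Fin n) ℂ}
    (hM : ∀ i j, ContDiffAt ℝ ∞ (fun y => M y i j) x₀)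
    (hN : ∀ i j, ContDiffAt ℝ ∞ (fun y => N y i j) x₀) (i j : Fin n) :
    ContDiffAt ℝ ∞ (fun y => (M y * N y) i j) x₀ := by
  simp only [Matrix.mul_apply]
  exact ContDiffAt.sum fun k _ => (hM i k).mul (hN k j)

theorem contDiffAt_matrix_sub_smul_one {n : ℕ} {M : V → Matrix (Fin n) (Fin n) ℂ}
    (hM : ∀ i j, ContDiffAt ℝ ∞ (fun y => M y i j) x₀) (l : ℂ) (i j : Fin n) :
    ContDiffAt ℝ ∞ (fun y => (M y - l • (1 : Matrix (Fin n) (Fin n) ℂ)) i j) x₀ :=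
  (hM i j).sub contDiffAt_const

theorem matrixGerm_mul {n : ℕ} {M N : V → Matrix (Fin n) (Fin n) ℂ}
    (hM : ∀ i j, ContDiffAt ℝ ∞ (fun y => M y i j) x₀)
    (hN : ∀ i j, ContDiffAt ℝ ∞ (fun y => N y i j) x₀) :
    matrixGerm M hM * matrixGerm N hN =
      matrixGerm (fun y => M y * N y) (contDiffAt_matrix_mul hM hN) := by
  ext1 i j
  simp only [matrixGerm, Matrix.mul_apply, Matrix.of_apply, smoothGerm_mul]
  rw [smoothGerm_sum _ (fun k y => M y i k * N y k j)]

theorem matrixGerm_sub_smul_one {n : ℕ} {M : V → Matrix (Fin n) (Fin n) ℂ}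
    (hM : ∀ i j, ContDiffAt ℝ ∞ (fun y => M y i j) x₀) (l : ℂ) :
    matrixGerm M hM - algebraMap ℂ (smoothGerms x₀) l • 1 =
      matrixGerm (fun y => M y - l • (1 : Matrix (Fin n) (Fin n) ℂ))
        (contDiffAt_matrix_sub_smul_one hM l) := by
  ext1 i j
  have h : (algebraMap ℂ (smoothGerms x₀) l • (1 : Matrix (Fin n) (Fin n) (smoothGerms x₀))) i j =
      algebraMap ℂ (smoothGerms x₀) ((l • (1 : Matrix (Fin n) (Fin n) ℂ)) i j) := by
    by_cases hij : i = j <;> simp [hij]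
  rw [Matrix.sub_apply, h, algebraMap_smoothGerms]
  rfl

theorem matrixGerm_eq_zero {n : ℕ} {M : V → Matrix (Fin n) (Fin n) ℂ}
    {hM : ∀ i j, ContDiffAt ℝ ∞ (fun y => M y i j) x₀} (h : ∀ᶠ y in 𝓝 x₀, M y = 0) :
    matrixGerm M hM = 0 := by
  ext1 i j
  rw [Matrix.zero_apply, ← map_zero (algebraMap ℂ (smoothGerms x₀)), algebraMap_smoothGerms]
  refine (smoothGerm_eq (hf := hM i j)).mpr ?_
  filter_upwards [h] with y hy
  rw [hy, Matrix.zero_apply]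

theorem contDiffAt_ofReal {f : V → ℝ} (hf : ContDiffAt ℝ ∞ f x₀) :
    ContDiffAt ℝ ∞ (fun y => (f y : ℂ)) x₀ :=
  Complex.ofRealCLM.contDiff.contDiffAt.comp x₀ hf

theorem contDiffAt_coord {m : ℕ} {f : V → EuclideanSpace ℝ (Fin m)} (hf : ContDiffAt ℝ ∞ f x₀)
    (i : Fin m) : ContDiffAt ℝ ∞ (fun y => f y i) x₀ :=
  (EuclideanSpace.proj (𝕜 := ℝ) i).contDiff.contDiffAt.comp x₀ hf

/-- The vector of germs of a smooth map to `ℝ^m`. -/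
def vectorGerm {m : ℕ} (f : V → EuclideanSpace ℝ (Fin m)) (hf : ContDiffAt ℝ ∞ f x₀) :
    Fin m → smoothGerms x₀ :=
  fun i => smoothGerm (fun y => (f y i : ℂ)) (contDiffAt_ofReal (contDiffAt_coord hf i))

theorem derivVec_vectorGerm {m : ℕ} {f : V → EuclideanSpace ℝ (Fin m)}
    (hf : ContDiffAt ℝ ∞ f x₀) (w : V) :
    derivVec (smoothGermDeriv x₀ w) (vectorGerm f hf) =
      vectorGerm (fun y => fderiv ℝ f y w) (contDiffAt_fderiv_apply hf w) := by
  ext1 i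
  refine (smoothGerm_eq (hf := contDiffAt_fderiv_apply
    (contDiffAt_ofReal (contDiffAt_coord hf i)) w)).mpr ?_
  filter_upwards [eventually_differentiableAt hf] with y hy
  have h := ((Complex.ofRealCLM.comp (EuclideanSpace.proj (𝕜 := ℝ) i)).hasFDerivAt.comp y
    hy.hasFDerivAt).fderiv
  exact DFunLike.congr_fun h w

/-- The signs of the coordinates of `ℝ^m_s`. -/
def signature (m s : ℕ) (i : Fin m) : ℂ := if (i : ℕ) < s then -1 else 1

theorem contDiffAt_pseudoInner {m : ℕ} (s : ℕ) {f g : V → EuclideanSpace ℝ (Fin m)}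
    (hf : ContDiffAt ℝ ∞ f x₀) (hg : ContDiffAt ℝ ∞ g x₀) :
    ContDiffAt ℝ ∞ (fun y => pseudoInner m s (f y) (g y)) x₀ := by
  simp only [pseudoInner_apply]
  exact ContDiffAt.sum fun i _ =>
    contDiffAt_const.mul ((contDiffAt_coord hf i).mul (contDiffAt_coord hg i))

theorem diagForm_vectorGerm {m : ℕ} (s : ℕ) {f g : V → EuclideanSpace ℝ (Fin m)}
    (hf : ContDiffAt ℝ ∞ f x₀) (hg : ContDiffAt ℝ ∞ g x₀) :
    diagForm (smoothGerms x₀) (signature m s) (vectorGerm f hf) (vectorGerm g hg) =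
      smoothGerm (fun y => (pseudoInner m s (f y) (g y) : ℂ))
        (contDiffAt_ofReal (contDiffAt_pseudoInner s hf hg)) := by
  simp only [diagForm_apply, vectorGerm, algebraMap_smoothGerms, smoothGerm_mul]
  rw [smoothGerm_sum _ (fun i y => signature m s i * ((f y i : ℂ) * (g y i : ℂ)))]
  refine smoothGerm_eq.mpr (Eventually.of_forall fun y => ?_)
  simp only [pseudoInner_apply, Complex.ofReal_sum]
  refine Finset.sum_congr rfl fun i _ => ?_
  by_cases h : (i : ℕ) < s <;> simp [signature, h]

theorem diagForm_vectorGerm_const {m : ℕ} {s : ℕ} {f g : V → EuclideanSpace ℝ (Fin m)}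
    (hf : ContDiffAt ℝ ∞ f x₀) (hg : ContDiffAt ℝ ∞ g x₀) {c : ℝ}
    (h : ∀ᶠ y in 𝓝 x₀, pseudoInner m s (f y) (g y) = c) :
    diagForm (smoothGerms x₀) (signature m s) (vectorGerm f hf) (vectorGerm g hg) =
      algebraMap ℂ (smoothGerms x₀) c := by
  rw [diagForm_vectorGerm, algebraMap_smoothGerms]
  exact smoothGerm_eq.mpr (h.mono fun y hy => by rw [hy])

/-- The operators `S y` determined by `Dn = -Df ∘ S` depend smoothly on `y`, if `f` is an
immersion. -/
theorem contDiffAt_weingarten [FiniteDimensional ℝ V] {F : Type*} [NormedAddCommGroup F]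
    [NormedSpace ℝ F] [FiniteDimensional ℝ F] {f n : V → F} (hf : ContDiffAt ℝ ∞ f x₀)
    (hn : ContDiffAt ℝ ∞ n x₀) (hinj : Function.Injective (fderiv ℝ f x₀)) {S : V → V →ₗ[ℝ] V}
    (hS : ∀ᶠ y in 𝓝 x₀, ∀ w, fderiv ℝ n y w = -fderiv ℝ f y (S y w)) (w : V) :
    ContDiffAt ℝ ∞ (fun y => S y w) x₀ := by
  have : CompleteSpace V := FiniteDimensional.complete ℝ V
  -- With a fixed left inverse `L` of `Df(x₀)`, the operator `L ∘ Df(y)` is the identity at `x₀` and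
  -- invertible nearby, so `S y = -(L ∘ Df(y))⁻¹ ∘ L ∘ Dn(y)`.
  obtain ⟨L, hL⟩ := (fderiv ℝ f x₀).toLinearMap.exists_leftInverse_of_injective
    (LinearMap.ker_eq_bot.mpr hinj)
  set L' : F →L[ℝ] V := LinearMap.toContinuousLinearMap L
  have hQ : ContDiffAt ℝ ∞ (fun y => L'.comp (fderiv ℝ f y)) x₀ :=
    contDiffAt_const.clm_comp (hf.fderiv_right (m := ∞) (by simp))
  have hQ0 : L'.comp (fderiv ℝ f x₀) = 1 := by
    ext v
    exact DFunLike.congr_fun hL v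
  have hinv : ContDiffAt ℝ ∞ (fun y => Ring.inverse (L'.comp (fderiv ℝ f y))) x₀ := by
    have h1 : ContDiffAt ℝ ∞ (Ring.inverse : (V →L[ℝ] V) → V →L[ℝ] V)
        (L'.comp (fderiv ℝ f x₀)) := by
      rw [hQ0]
      exact contDiffAt_ringInverse ℝ (1 : (V →L[ℝ] V)ˣ)
    exact h1.comp x₀ hQ
  have hres : ContDiffAt ℝ ∞ (fun y => Ring.inverse (L'.comp (fderiv ℝ f y))
      (-(L' (fderiv ℝ n y w)))) x₀ :=
    hinv.clm_apply (contDiffAt_const.clm_apply (contDiffAt_fderiv_apply hn w)).neg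
  refine hres.congr_of_eventuallyEq ?_
  have hunit : ∀ᶠ y in 𝓝 x₀, IsUnit (L'.comp (fderiv ℝ f y)) :=
    hQ.continuousAt.eventually_mem (by
      rw [hQ0]
      exact Units.isOpen.mem_nhds isUnit_one)
  filter_upwards [hS, hunit] with y hy hu
  simp only [hy, map_neg, neg_neg]
  change S y w = (Ring.inverse (L'.comp (fderiv ℝ f y)) * L'.comp (fderiv ℝ f y)) (S y w)
  rw [Ring.inverse_mul_cancel _ hu]
  rfl

theorem mul_eq_zero_of_charpoly {n : ℕ} {A : Matrix (Fin n) (Fin n) ℂ} {l₁ l₂ b : ℂ}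
    (h : A.charpoly = (Polynomial.X - Polynomial.C l₁) * ((Polynomial.X - Polynomial.C l₂) *
      ((Polynomial.X - Polynomial.C b) * (Polynomial.X - Polynomial.C b)))) :
    (A - l₁ • (1 : Matrix (Fin n) (Fin n) ℂ)) * ((A - l₂ • (1 : Matrix (Fin n) (Fin n) ℂ)) *
      ((A - b • (1 : Matrix (Fin n) (Fin n) ℂ)) * (A - b • (1 : Matrix (Fin n) (Fin n) ℂ)))) =
      0 := by
  have h2 := Matrix.aeval_self_charpoly A
  simpa only [h, map_mul, map_sub, Polynomial.aeval_X, Polynomial.aeval_C,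
    Algebra.algebraMap_eq_smul_one] using h2

/-- The Gauss equation for a hypersurface in coordinates whose shape operator is of type IV at one
point and has constant characteristic polynomial. -/
theorem local_curvature [FiniteDimensional ℝ V] {f n : V → EuclideanSpace ℝ (Fin 6)} {s : ℕ}
    (hf : ContDiffAt ℝ ∞ f x₀) (hn : ContDiffAt ℝ ∞ n x₀)
    (hinj : Function.Injective (fderiv ℝ f x₀)) {S : V → V →ₗ[ℝ] V}
    (hS : ∀ᶠ y in 𝓝 x₀, ∀ w, fderiv ℝ n y w = -fderiv ℝ f y (S y w))
    {ν α β b ε : ℝ} (hν : ν * ν = 1) (hβ : β ≠ 0) (hε : ε ≠ 0)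
    (hff : ∀ᶠ y in 𝓝 x₀, pseudoInner 6 s (f y) (f y) = 1)
    (hnf : ∀ᶠ y in 𝓝 x₀, pseudoInner 6 s (n y) (f y) = 0)
    (hnn : ∀ᶠ y in 𝓝 x₀, pseudoInner 6 s (n y) (n y) = ν)
    (hdfn : ∀ᶠ y in 𝓝 x₀, ∀ w, pseudoInner 6 s (fderiv ℝ f y w) (n y) = 0)
    (hchar : ∀ᶠ y in 𝓝 x₀, ((S y).charpoly).map (algebraMap ℝ ℂ) =
      (Polynomial.X - Polynomial.C (α + β * Complex.I : ℂ)) *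
        ((Polynomial.X - Polynomial.C (α - β * Complex.I : ℂ)) *
          ((Polynomial.X - Polynomial.C (b : ℂ)) * (Polynomial.X - Polynomial.C (b : ℂ)))))
    (W : Module.Basis (Fin 4) ℝ V)
    (hSW : LinearMap.toMatrix W W (S x₀) = !![α, -β, 0, 0; β, α, 0, 0; 0, 0, b, 1; 0, 0, 0, b])
    (hGW : Matrix.of (fun i j => pseudoInner 6 s (fderiv ℝ f x₀ (W i)) (fderiv ℝ f x₀ (W j))) =
      !![-1, 0, 0, 0; 0, 1, 0, 0; 0, 0, 0, ε; 0, 0, ε, 0]) :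
    1 + ν * (α ^ 2 + β ^ 2) = 0 := by
  set A : V → Matrix (Fin 4) (Fin 4) ℂ :=
    fun y => (LinearMap.toMatrix W W (S y)).map (algebraMap ℝ ℂ) with hAdef
  have hAe : ∀ y i j, A y i j = (W.repr (S y (W j)) i : ℂ) := fun y i j => by
    simp [hAdef, LinearMap.toMatrix_apply]
  have hA : ∀ i j, ContDiffAt ℝ ∞ (fun y => A y i j) x₀ := by
    intro i j
    simp only [hAe]
    exact contDiffAt_ofReal ((LinearMap.toContinuousLinearMap (W.coord i)).contDiff.contDiffAt.comp
      x₀ (contDiffAt_weingarten hf hn hinj hS (W j)))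
  have hdf := fun i => derivVec_vectorGerm hf (W i)
  have key := curvature_of_petrovTypeIV (d := fun i => smoothGermDeriv x₀ (W i))
    (fun i j φ => smoothGermDeriv_comm (W i) (W j) φ) (smoothGermEval x₀) exists_sqrt_inv
    (s := signature 6 s) (x := vectorGerm f hf) (ξ := vectorGerm n hn) (A := matrixGerm A hA)
    (ν := ν) (by exact_mod_cast hν) hβ hε
    (by simpa using diagForm_vectorGerm_const hf hf hff)
    (by simpa using diagForm_vectorGerm_const hn hf hnf)
    (diagForm_vectorGerm_const hn hn hnn)
    (fun i => by
      rw [hdf]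
      simpa using diagForm_vectorGerm_const _ hn (hdfn.mono fun y hy => hy (W i)))
    (fun j => by
      ext1 t
      simp only [hdf, derivVec_vectorGerm]
      simp only [Pi.neg_apply, Finset.sum_apply, Pi.smul_apply, smul_eq_mul]
      rw [eq_neg_iff_add_eq_zero, ← map_zero (algebraMap ℂ (smoothGerms x₀)),
        algebraMap_smoothGerms]
      simp only [matrixGerm, Matrix.of_apply, vectorGerm, smoothGerm_mul]
      rw [smoothGerm_sum _ (fun k y => A y k j * ((fderiv ℝ f y (W k)) t : ℂ)), smoothGerm_add,
        smoothGerm_eq]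
      filter_upwards [hS] with y hy
      have h := congrArg (fderiv ℝ f y) (W.sum_repr (S y (W j)))
      rw [map_sum] at h
      rw [hy, ← h]
      simp [hAe])
    (by
      -- The Jordan form is given only at `x₀`; nearby, Cayley–Hamilton and the constant
      -- characteristic polynomial supply the annihilating relation.
      rw [matrixGerm_sub_smul_one, matrixGerm_sub_smul_one, matrixGerm_sub_smul_one,
        matrixGerm_mul, matrixGerm_mul, matrixGerm_mul]
      apply matrixGerm_eq_zero
      filter_upwards [hchar] with y hy
      refine mul_eq_zero_of_charpoly ?_
      rw [hAdef, Matrix.charpoly_map, LinearMap.charpoly_toMatrix, hy])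
    (fun i j => by
      rw [matrixGerm, Matrix.of_apply, smoothGermEval_mk, ← hSW]
      rfl)
    (fun i j => by
      rw [hdf, hdf, diagForm_vectorGerm, smoothGermEval_mk, ← hGW]
      rfl)
  exact_mod_cast key

end LocalCurvature
-- Spectrum of the type IV normal form.
theorem charpoly_petrovTypeIV {V : Type*} [AddCommGroup V] [Module ℝ V] [Module.Finite ℝ V]
    {A : V →ₗ[ℝ] V} {α β b : ℝ} (e : Module.Basis (Fin 4) ℝ V)
    (hA : LinearMap.toMatrix e e A = !![α, -β, 0, 0; β, α, 0, 0; 0, 0, b, 1; 0, 0, 0, b]) :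
    A.charpoly.map (algebraMap ℝ ℂ) =
      (Polynomial.X - Polynomial.C (α + β * Complex.I : ℂ)) *
        ((Polynomial.X - Polynomial.C (α - β * Complex.I : ℂ)) *
          ((Polynomial.X - Polynomial.C (b : ℂ)) * (Polynomial.X - Polynomial.C (b : ℂ)))) := by
  have hI : (Polynomial.C Complex.I : Polynomial ℂ) * Polynomial.C Complex.I = -1 := by
    rw [← map_mul, Complex.I_mul_I, map_neg, map_one]
  rw [← LinearMap.charpoly_toMatrix A e, hA, Matrix.charpoly, Matrix.det_succ_row_zero]
  simp [Fin.sum_univ_four, Matrix.det_fin_three, Matrix.charmatrix, Fin.succAbove]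
  linear_combination ((Polynomial.X : Polynomial ℂ) - Polynomial.C (b : ℂ)) ^ 2 *
    Polynomial.C (β : ℂ) ^ 2 * hI

theorem hasEigenvalue_petrovTypeIV_iff {V : Type*} [AddCommGroup V] [Module ℝ V]
    {A : V →ₗ[ℝ] V} {α β b : ℝ} (e : Module.Basis (Fin 4) ℝ V)
    (hA : LinearMap.toMatrix e e A = !![α, -β, 0, 0; β, α, 0, 0; 0, 0, b, 1; 0, 0, 0, b])
    (μ : ℂ) : Module.End.HasEigenvalue (A.baseChange ℂ) μ ↔
      μ = α + β * Complex.I ∨ μ = α - β * Complex.I ∨ μ = b := by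
  have : Module.Finite ℝ V := Module.Finite.of_basis e
  rw [Module.End.hasEigenvalue_iff_isRoot_charpoly, LinearMap.charpoly_baseChange,
    charpoly_petrovTypeIV e hA]
  simp [sub_eq_zero]

/-! ### Weingarten formula and passage to a chart. -/

namespace Hypersurface

variable {n s : ℕ} {M : Type*} [TopologicalSpace M] [ChartedSpace (EuclideanSpace ℝ (Fin n)) M]

/-- Polarization: `x + ξ` has constant square `1 + ν`. Differentiating leaves `⟨Dξ, x⟩ + ⟨Dx, ξ⟩ =
0`, whose second term vanishes. Hence the covariant derivative of `ξ` is its flat derivative. -/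
theorem pseudoInner_diff_normal_toFun (X : Hypersurface n s M) (p : M)
    (v : TangentSpace (𝓡 n) p) :
    pseudoInner (n + 2) s (diff X.normal p v) (X.toFun p) = 0 := by
  have hadd : diff (fun q => X.toFun q + X.normal q) p v =
      diff X.toFun p v + diff X.normal p v := by
    have h := mfderiv_add (X.smooth.mdifferentiable (by simp) p)
      (X.normal_smooth.mdifferentiable (by simp) p)
    exact DFunLike.congr_fun h v
  have h := pseudoInner_diff_self (s := s) (X.smooth.add X.normal_smooth) (c := 1 + X.sign) (fun q => by
    simp [(X.mem_sphere q).1, X.normal_unit, X.normal_tangent,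
      pseudoInner_comm _ _ (X.toFun q) (X.normal q)]) p v
  change pseudoInner (n + 2) s (diff (fun q => X.toFun q + X.normal q) p v)
    (X.toFun p + X.normal p) = 0 at h
  rw [hadd] at h
  simp only [map_add, LinearMap.add_apply] at h
  have h1 := pseudoInner_diff_self X.smooth (fun q => (X.mem_sphere q).1) p v
  have h2 := pseudoInner_diff_self X.normal_smooth X.normal_unit p v
  have h3 : pseudoInner (n + 2) s (X.normal p) (diff X.toFun p v) = 0 := X.normal_orthogonal p v
  rw [pseudoInner_comm] at h3
  linarith

theorem diff_normal (X : Hypersurface n s M) (p : M) (v : TangentSpace (𝓡 n) p) :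
    diff X.normal p v = -diff X.toFun p (X.shapeOperator p v) := by
  rw [diff_shapeOperator, covDeriv_apply, pseudoInner_diff_normal_toFun, zero_smul, sub_zero,
    neg_neg]

variable [IsManifold (𝓡 n) ∞ M]

theorem contDiffAt_comp_chart_symm {F : Type*} [NormedAddCommGroup F] [NormedSpace ℝ F]
    {η : M → F} (hη : ContMDiff (𝓡 n) 𝓘(ℝ, F) ∞ η) (p : M) {y : EuclideanSpace ℝ (Fin n)}
    (hy : y ∈ (extChartAt (𝓡 n) p).target) :
    ContDiffAt ℝ ∞ (η ∘ (extChartAt (𝓡 n) p).symm) y := by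
  rw [← contMDiffAt_iff_contDiffAt]
  exact hη.contMDiffAt.comp y ((contMDiffOn_extChartAt_symm p).contMDiffAt
    ((isOpen_extChartAt_target p).mem_nhds hy))

/-- The derivative of the inverse of a chart, as a linear equivalence. -/
theorem exists_chart_symm_equiv (p : M) {y : EuclideanSpace ℝ (Fin n)}
    (hy : y ∈ (extChartAt (𝓡 n) p).target) :
    ∃ Φ : EuclideanSpace ℝ (Fin n) ≃ₗ[ℝ] TangentSpace (𝓡 n) ((extChartAt (𝓡 n) p).symm y),
      ∀ η : M → EuclideanSpace ℝ (Fin (n + 2)),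
        ContMDiff (𝓡 n) 𝓘(ℝ, EuclideanSpace ℝ (Fin (n + 2))) ∞ η → ∀ w,
          fderiv ℝ (η ∘ (extChartAt (𝓡 n) p).symm) y w =
            diff η ((extChartAt (𝓡 n) p).symm y) (Φ w) := by
  have : IsManifold (𝓡 n) 1 M := IsManifold.of_le (n := ∞) (by simp)
  obtain ⟨Φ, hΦ⟩ := isInvertible_mfderivWithin_extChartAt_symm (I := 𝓡 n) hy
  refine ⟨Φ.toLinearEquiv, fun η hη w => ?_⟩
  have hd : MDifferentiableAt 𝓘(ℝ, EuclideanSpace ℝ (Fin n)) (𝓡 n)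
      (extChartAt (𝓡 n) p).symm y := by
    have h := mdifferentiableWithinAt_extChartAt_symm (I := 𝓡 n) hy
    rwa [modelWithCornersSelf_coe, Set.range_id, mdifferentiableWithinAt_univ] at h
  have h1 := mfderiv_comp y (hη.mdifferentiable (by simp) _) hd
  rw [mfderiv_eq_fderiv] at h1
  rw [modelWithCornersSelf_coe, Set.range_id, mfderivWithin_univ] at hΦ
  rw [← hΦ] at h1
  exact DFunLike.congr_fun h1 w

/-- The operator is the shape operator conjugated by the derivative of the inverse chart.
Transporting bases the same way preserves both the matrix of the operator and the Gram matrix. -/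
theorem exists_shapeOperator_in_chart (X : Hypersurface n s M) (p : M)
    {y : EuclideanSpace ℝ (Fin n)} (hy : y ∈ (extChartAt (𝓡 n) p).target) :
    ∃ T : EuclideanSpace ℝ (Fin n) →ₗ[ℝ] EuclideanSpace ℝ (Fin n),
      (∀ w, fderiv ℝ (X.normal ∘ (extChartAt (𝓡 n) p).symm) y w =
        -fderiv ℝ (X.toFun ∘ (extChartAt (𝓡 n) p).symm) y (T w)) ∧
      Function.Injective (fderiv ℝ (X.toFun ∘ (extChartAt (𝓡 n) p).symm) y) ∧
      (∀ w, pseudoInner (n + 2) s (fderiv ℝ (X.toFun ∘ (extChartAt (𝓡 n) p).symm) y w)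
        (X.normal ((extChartAt (𝓡 n) p).symm y)) = 0) ∧
      ∀ e : Module.Basis (Fin n) ℝ (TangentSpace (𝓡 n) ((extChartAt (𝓡 n) p).symm y)),
        ∃ W : Module.Basis (Fin n) ℝ (EuclideanSpace ℝ (Fin n)),
          LinearMap.toMatrix W W T =
            LinearMap.toMatrix e e (X.shapeOperator ((extChartAt (𝓡 n) p).symm y)) ∧
          ∀ i, fderiv ℝ (X.toFun ∘ (extChartAt (𝓡 n) p).symm) y (W i) =
            diff X.toFun ((extChartAt (𝓡 n) p).symm y) (e i) := by
  have hequiv := exists_chart_symm_equiv p hy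
  set q := (extChartAt (𝓡 n) p).symm y
  obtain ⟨Φ, hΦ⟩ := hequiv
  refine ⟨Φ.symm.toLinearMap ∘ₗ X.shapeOperator q ∘ₗ Φ.toLinearMap, fun w => ?_, ?_, fun w => ?_,
    fun e => ⟨e.map Φ.symm, ?_, fun i => ?_⟩⟩
  · rw [hΦ _ X.normal_smooth, hΦ _ X.smooth, diff_normal]
    simp
  · intro v w h
    rw [hΦ _ X.smooth, hΦ _ X.smooth] at h
    exact Φ.injective (X.diff_injective q h)
  · rw [hΦ _ X.smooth, pseudoInner_comm]
    exact X.normal_orthogonal q (Φ w)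
  · ext i j
    simp [LinearMap.toMatrix_apply]
  · rw [hΦ _ X.smooth]
    simp

end Hypersurface

/-- The set of eigenvalues determines the constants: positivity of `β` singles out the element of
the upper half plane, and `b` is the only real element. -/
theorem petrovTypeIV_constants_eq {α β b α' β' b' : ℝ} (hβ : 0 < β) (hβ' : 0 < β')
    (h : ∀ μ : ℂ, (μ = α + β * Complex.I ∨ μ = α - β * Complex.I ∨ μ = b) ↔
      (μ = α' + β' * Complex.I ∨ μ = α' - β' * Complex.I ∨ μ = b')) :
    α = α' ∧ β = β' ∧ b = b' := by
  have h1 := (h (α + β * Complex.I)).mp (Or.inl rfl)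
  have h2 := (h b).mp (Or.inr (Or.inr rfl))
  simp [Complex.ext_iff] at h1 h2
  refine ⟨?_, ?_, ?_⟩
  · rcases h1 with h1 | h1 | h1
    · exact h1.1
    · exact h1.1
    · exact absurd h1.2 hβ.ne'
  · rcases h1 with h1 | h1 | h1
    · exact h1.2
    · linarith [h1.2]
    · exact absurd h1.2 hβ.ne'
  · rcases h2 with h2 | h2 | h2
    · exact absurd h2.2 (by linarith)
    · exact absurd h2.2 (by linarith)
    · exact h2

end PseudoSphere

theorem mainTheorem7 {M : Type*} [TopologicalSpace M] [ConnectedSpace M]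
    [ChartedSpace (EuclideanSpace ℝ (Fin 4)) M] [IsManifold (𝓡 4) ∞ M]
    (X : PseudoSphere.Hypersurface 4 3 M)
    (hiso : X.IsIsoparametric) (htype : X.HasPetrovTypeIV)
    (p : M) (μ : ℂ) (hμ : X.IsPrincipalCurvatureAt p μ) (hμ_im : μ.im ≠ 0) :
    ‖μ‖ = 1 := by
  set φ := extChartAt (𝓡 4) p with hφ
  have hx₀ : φ p ∈ φ.target := mem_extChartAt_target p
  have htarget : ∀ᶠ y in nhds (φ p), y ∈ φ.target := extChartAt_target_mem_nhds p
  obtain ⟨α, β, b, ε, e, hβ, hε, hA, hg⟩ := htype (φ.symm (φ p))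
  have heig := PseudoSphere.hasEigenvalue_petrovTypeIV_iff e hA
  have hchart := fun y (hy : y ∈ φ.target) => X.exists_shapeOperator_in_chart p hy
  choose! S hS hinj horth hbasis using hchart
  obtain ⟨W, hW, hWe⟩ := hbasis _ hx₀ e
  -- Isoparametricity fixes only the set of principal curvatures; the Petrov type at each point
  -- supplies the multiplicities.
  have hchar : ∀ y ∈ φ.target, ((S y).charpoly).map (algebraMap ℝ ℂ) =
      (Polynomial.X - Polynomial.C (α + β * Complex.I : ℂ)) *
        ((Polynomial.X - Polynomial.C (α - β * Complex.I : ℂ)) *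
          ((Polynomial.X - Polynomial.C (b : ℂ)) * (Polynomial.X - Polynomial.C (b : ℂ)))) := by
    intro y hy
    obtain ⟨α', β', b', ε', e', hβ', -, hA', -⟩ := htype (φ.symm y)
    obtain ⟨rfl, rfl, rfl⟩ := PseudoSphere.petrovTypeIV_constants_eq hβ hβ' fun l =>
      (heig l).symm.trans ((hiso _ _ l).trans (PseudoSphere.hasEigenvalue_petrovTypeIV_iff e' hA' l))
    obtain ⟨W', hW', -⟩ := hbasis y hy e'
    exact PseudoSphere.charpoly_petrovTypeIV W' (hW'.trans hA')
  have key := PseudoSphere.local_curvature (s := 3) (ν := X.sign)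
    (PseudoSphere.Hypersurface.contDiffAt_comp_chart_symm X.smooth p hx₀)
    (PseudoSphere.Hypersurface.contDiffAt_comp_chart_symm X.normal_smooth p hx₀)
    (hinj _ hx₀) (htarget.mono hS)
    (by rcases X.sign_eq with h | h <;> simp [h]) hβ.ne'
    (show ε ≠ 0 by rcases hε with h | h <;> simp [h])
    (Filter.Eventually.of_forall fun y => (X.mem_sphere _).1)
    (Filter.Eventually.of_forall fun y => X.normal_tangent _)
    (Filter.Eventually.of_forall fun y => X.normal_unit _)
    (htarget.mono horth) (htarget.mono hchar) W (hW.trans hA)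
    (by
      rw [← hg]
      ext i j
      simp only [Matrix.of_apply]
      rw [hWe, hWe]
      rfl)
  -- The sign `+1` would make `1 + α² + β²` vanish, so the normal is timelike.
  have hsq : α ^ 2 + β ^ 2 = 1 := by
    rcases X.sign_eq with h | h <;> rw [h] at key <;> nlinarith [sq_nonneg α, sq_nonneg β]
  have hnorm : ‖μ‖ ^ 2 = 1 := by
    rw [← Complex.normSq_eq_norm_sq]
    rcases (heig μ).mp ((hiso p _ μ).mp hμ) with h | h | h
    · rw [h, Complex.normSq_apply]
      simp
      linarith
    · rw [h, Complex.normSq_apply]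
      simp
      linarith
    · exact absurd (by rw [h, Complex.ofReal_im]) hμ_im
  exact (pow_eq_one_iff_of_nonneg (norm_nonneg μ) two_ne_zero).mp hnorm
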